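/- Let $\mathcal X$ be a finite nonempty set (for example a finite subset of $\mathbb R^d$), let $k:\mathcal X\times\mathcal X\to\mathbb R$ be a positive semidefinite kernel with $k(x,x)\le 1$ for all $x$, let $\sigma>0$, and let $f\sim\mathcal{GP}(0,k)$ be a centred Gaussian process on $\mathcal X$ with covariance $k$. Let $\epsilon_1,\epsilon_2,\dots$ be i.i.d. $\mathcal N(0,\sigma^2)$, and let $\zeta_1,\zeta_2,\dots$ be i.i.d. with the shifted exponential distribution of density $p(\zeta)=\lambda e^{-\lambda(\zeta-s)}\mathbf 1\{\zeta\ge s\}$, with the constant ($t$-independent) shift $s=2\log(|\mathcal X|/2)$ and rate $\lambda=1/2$; the objects $f$, $(\epsilon_t)_t$, $(\zeta_t)_t$ are mutually independent. IRGP-UCB runs as follows. In round $t=1,2,\dots$, given the data $\mathcal D_{t-1}=\{(x_i,y_i)\}_{i=1}^{t-1}$, with $\mathbf y=(y_1,\dots,y_{t-1})^\top$, $\mathbf K=(k(x_i,x_j))_{i,j<t}$ and $\mathbf k(x)=(k(x,x_1),\dots,k(x,x_{t-1}))^\top$, put $$\mu_{t-1}(x)=\mathbf k(x)^\top(\mathbf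 K+\sigma^2\mathbf I)^{-1}\mathbf y,\qquad \sigma_{t-1}^2(x)=k(x,x)-\mathbf k(x)^\top(\mathbf K+\sigma^2\mathbf I)^{-1}\mathbf k(x),$$ choose $x_t\in\arg\max_{x\in\mathcal X}\ \mu_{t-1}(x)+\zeta_t^{1/2}\sigma_{t-1}(x)$, and observe $y_t=f(x_t)+\epsilon_t$. Ties are broken in any measurable way as a function of $\mathcal D_{t-1}$ and $\zeta_1,\dots,\zeta_t$. (If $|\mathcal X|=1$, where $\zeta_t$ may be negative, the choice of $x_t$ is trivial.) Let $\gamma_T=\max_{a_1,\dots,a_T\in\mathcal X} I(\mathbf y_A;\mathbf f_A)$ be the maximum information gain, where repetitions among the $a_i$ are allowed, $\mathbf f_A=(f(a_i))_{i=1}^T$, $\mathbf y_A=(f(a_i)+\epsilon_i)_{i=1}^T$, and $I$ is the Shannon mutual information in nats. Then for every $T\ge 0$ the cumulative regret $\sum_{t=1}^T\bigl(\max_{x\in\mathcal X} f(x)-f(x_t)\bigr)$ is integrable, and its expectation over all the randomness of $f$, $(\epsilon_t)_t$, $(\zeta_t)_t$, the Bayesian cumulative regret $\mathrm{BCR}_T$,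 satisfies $$\mathrm{BCR}_T\le\sqrt{C_1C_2\,T\,\gamma_T},\qquad C_1=\frac{2}{\log(1+\sigma^{-2})},\qquad C_2=2+2\log(|\mathcal X|/2).$$ -/

import Mathlib

open MeasureTheory ProbabilityTheory
open scoped ENNReal Matrix

noncomputable section

namespace IRGPUCB

/-! ### Gaussian process model -/

/-- The family `f` of real random variables indexed by `X` is a sample path of the Gaussian
process `GP(0, k)` under `P`. -/
structure IsGPSample {X Ω : Type*} [MeasurableSpace Ω] (k : X → X → ℝ) (f : X → Ω → ℝ)
    (P : Measure Ω) : Prop where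
  measurable : ∀ x, Measurable (f x)
  isGaussianProcess : IsGaussianProcess f P
  mean_eq_zero : ∀ x, ∫ ω, f x ω ∂P = 0
  covariance_eq : ∀ x x', cov[f x, f x'; P] = k x x'

/-- Kernel matrix `K` of the query points `a₀, …, a₍ₜ₋₁₎`. -/
def kernelMatrix {X : Type*} (k : X → X → ℝ) {t : ℕ} (a : Fin t → X) :
    Matrix (Fin t) (Fin t) ℝ :=
  Matrix.of fun i j => k (a i) (a j)

/-- The vector `(k(z, a₀), …, k(z, a₍ₜ₋₁₎))`. -/
def kernelVec {X : Type*} (k : X → X → ℝ) {t : ℕ} (a : Fin t → X) (z : X) : Fin t → ℝ :=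
  fun i => k z (a i)

/-- Posterior mean at `z` given the data set `D = ((a₀, y₀), …, (a₍ₜ₋₁₎, y₍ₜ₋₁₎))`. -/
def postMean {X : Type*} (k : X → X → ℝ) (σ : ℝ) {t : ℕ} (D : Fin t → X × ℝ) (z : X) : ℝ :=
  kernelVec k (fun i => (D i).1) z ⬝ᵥ
    ((kernelMatrix k (fun i => (D i).1) + σ ^ 2 • (1 : Matrix (Fin t) (Fin t) ℝ))⁻¹ *ᵥ
      fun i => (D i).2)

/-- Posterior variance at `z` given the data set `D`. -/
def postVar {X : Type*} (k : X → X → ℝ) (σ : ℝ) {t : ℕ} (D : Fin t → X × ℝ) (z : X) : ℝ :=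
  k z z - kernelVec k (fun i => (D i).1) z ⬝ᵥ
    ((kernelMatrix k (fun i => (D i).1) + σ ^ 2 • (1 : Matrix (Fin t) (Fin t) ℝ))⁻¹ *ᵥ
      kernelVec k (fun i => (D i).1) z)

/-- Upper confidence bound with confidence parameter `ζ`: posterior mean plus `√ζ` times the
posterior standard deviation. -/
def ucb {X : Type*} (k : X → X → ℝ) (σ ζ : ℝ) {t : ℕ} (D : Fin t → X × ℝ) (z : X) : ℝ :=
  postMean k σ D z + √ζ * √(postVar k σ D z)

/-! ### The shifted exponential distribution -/

/-- Density of the shifted exponential distribution with shift `s` and rate `r`. -/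
def shiftedExpPDFReal (s r z : ℝ) : ℝ :=
  if s ≤ z then r * Real.exp (-(r * (z - s))) else 0

/-- The shifted exponential distribution with shift `s` and rate `r`. -/
def shiftedExpMeasure (s r : ℝ) : Measure ℝ :=
  volume.withDensity fun z => ENNReal.ofReal (shiftedExpPDFReal s r z)

/-! ### The algorithm -/

/-- Noisy observation in round `t`. -/
def observation {X Ω : Type*} (f : X → Ω → ℝ) (ε : ℕ → Ω → ℝ) (x : ℕ → Ω → X) (t : ℕ) (ω : Ω) :
    ℝ :=
  f (x t ω) ω + ε t ω

/-- Data set available at the beginning of round `t`. Rounds are numbered `0, 1, 2, …`, so that it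
consists of the `t` pairs (query, observation) of the rounds `0, …, t - 1`. -/
def dataset {X Ω : Type*} (f : X → Ω → ℝ) (ε : ℕ → Ω → ℝ) (x : ℕ → Ω → X) (t : ℕ) (ω : Ω) :
    Fin t → X × ℝ :=
  fun i => (x i ω, observation f ε x i ω)

/-- `x` is the sequence of queries made by the randomized GP-UCB algorithm with confidence
parameters `ζ`: in every round the query is a maximizer of the upper confidence bound, and it is
chosen (ties included) on the basis of the current data set and of the confidence parameters
generated so far. -/
structure IsRun {X Ω : Type*} [MeasurableSpace X] (k : X → X → ℝ) (σ : ℝ)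
    (f : X → Ω → ℝ) (ε ζ : ℕ → Ω → ℝ) (x : ℕ → Ω → X) : Prop where
  adapted : ∀ t, Measurable[MeasurableSpace.comap
    (fun ω => (dataset f ε x t ω, fun i : Fin (t + 1) => ζ i ω)) inferInstance] (x t)
  isMax : ∀ t ω z,
    ucb k σ (ζ t ω) (dataset f ε x t ω) z ≤ ucb k σ (ζ t ω) (dataset f ε x t ω) (x t ω)

/-! ### Regret -/

/-- Cumulative regret of `T` rounds; on a finite nonempty domain the supremum is the maximum
`f(x*)`. -/
def cumRegret {X Ω : Type*} (f : X → Ω → ℝ) (x : ℕ → Ω → X) (T : ℕ) (ω : Ω) : ℝ :=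
  ∑ t ∈ Finset.range T, ((⨆ z, f z ω) - f (x t ω) ω)

/-- Bayesian cumulative regret: expectation of the cumulative regret over all the randomness. -/
def bcr {X Ω : Type*} [MeasurableSpace Ω] (P : Measure Ω) (f : X → Ω → ℝ) (x : ℕ → Ω → X)
    (T : ℕ) : ℝ :=
  ∫ ω, cumRegret f x T ω ∂P

/-! ### Maximum information gain -/

/-- Shannon mutual information (in nats) of two random variables: the Kullback–Leibler divergence
of their joint law from the product of their laws. -/
def mutualInfo {Ω α β : Type*} [MeasurableSpace Ω] [MeasurableSpace α] [MeasurableSpace β]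
    (P : Measure Ω) (Y : Ω → α) (F : Ω → β) : ℝ≥0∞ :=
  InformationTheory.klDiv (P.map fun ω => (Y ω, F ω)) ((P.map Y).prod (P.map F))

open scoped Classical in
/-- Joint law of the values of `f ∼ GP(0, k)` on the finite domain `X` and of `T` independent
noise variables with law `N(0, σ²)`, independent of `f`. -/
def modelMeasure {X : Type*} [Fintype X] (k : X → X → ℝ) (σ : ℝ) (T : ℕ) :
    Measure (EuclideanSpace ℝ X × (Fin T → ℝ)) :=
  (multivariateGaussian 0 (Matrix.of k)).prod
    (Measure.pi fun _ => gaussianReal 0 (Real.toNNReal (σ ^ 2)))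

/-- Information gain `I(y_A ; f_A)` of the points `a₀, …, a₍T₋₁₎` (repetitions allowed), where
`f_A = (f(aᵢ))ᵢ` and `y_A = (f(aᵢ) + εᵢ)ᵢ`. -/
def infoGain {X : Type*} [Fintype X] (k : X → X → ℝ) (σ : ℝ) {T : ℕ} (a : Fin T → X) : ℝ≥0∞ :=
  mutualInfo (modelMeasure k σ T) (fun p i => p.1 (a i) + p.2 i) (fun p i => p.1 (a i))

/-- Maximum information gain `γ_T`. -/
def maxInfoGain {X : Type*} [Fintype X] (k : X → X → ℝ) (σ : ℝ) (T : ℕ) : ℝ :=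
  (⨆ a : Fin T → X, infoGain k σ a).toReal

end IRGPUCB

end

noncomputable section

namespace IRGPUCB

/-! ### Gaussian posterior at fixed query points -/

/-! Fix a round and condition on the data. The posterior of `f z` is normal with mean `m z` and
variance `v z`. For a level `u`, let `q` be the least value of `(u - m z)² / v z`. The union bound
with the Gaussian tail `exp (-x² / 2) / 2` gives `P (max f > u) ≤ |X| / 2 * exp (-q / 2)`. The shift
and the rate of the exponential law are chosen so that the right side is exactly `P (ζ > q)`, and `ζ
> q` forces the upper confidence bound at the minimising `z` above `u`. Hence the tails of `max f`
are dominated by those of the maximal confidence bound, and so are the expectations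
(`integral_iSup_le_of_shiftedExp`).

The query attains the maximal confidence bound, and the posterior mean there is unbiased for `f (x
t)`. One round therefore costs at most `E[√ζ * √postVar]` (`integral_regret_le`). Cauchy–Schwarz
over rounds and randomness separates `E ζ = C₂` from the summed posterior variances. The latter are
bounded path by path by `C₁ * γ_T`: the information gain equals half the sum of `log (1 + σ⁻² *
variance)` (`mutualInfo_obs`), and `log` is concave (`sum_condVar_le`).

No conditional laws are used. As `X` is finite, the sample space splits into finitely many events
"the queries so far are `c`". For fixed `c` the posterior mean is linear in the observations, and
`f` minus it is a residual independent of them (`indepFun_residual_obs`) and of `ζ`. The event is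
itself a function of those observations and of `ζ` (`IsRun.measurableSet_history_eq`), so Fubini
does the conditioning (`setIntegral_eq_of_indepFun`). -/

/-- A sample `f` of `GP(0, k)` together with finitely many independent `N(0, σ²)` noise variables
that are independent of `f`. -/
structure IsNoisyGP {X Ω : Type*} [MeasurableSpace Ω] {t : ℕ} (k : X → X → ℝ) (σ : ℝ)
    (f : X → Ω → ℝ) (e : Fin t → Ω → ℝ) (P : Measure Ω) : Prop where
  gp : IsGPSample k f P
  noise_measurable : ∀ i, Measurable (e i)
  noise_law : ∀ i, HasLaw (e i) (gaussianReal 0 (Real.toNNReal (σ ^ 2))) P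
  noise_indep : iIndepFun e P
  indep : IndepFun (fun ω x => f x ω) (fun ω i => e i ω) P

/-- Noisy observations of `f` at the fixed points `a`. -/
def obs {X Ω : Type*} {t : ℕ} (f : X → Ω → ℝ) (e : Fin t → Ω → ℝ) (a : Fin t → X) (ω : Ω) :
    Fin t → ℝ :=
  fun i => f (a i) ω + e i ω

/-- Coefficients of the posterior mean at `z` as a linear function of the observations at `a`. -/
def postWeights {X : Type*} (k : X → X → ℝ) (σ : ℝ) {t : ℕ} (a : Fin t → X) (z : X) : Fin t → ℝ :=
  kernelVec k a z ᵥ* (kernelMatrix k a + σ ^ 2 • (1 : Matrix (Fin t) (Fin t) ℝ))⁻¹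

/-- Difference between `f z` and its posterior mean. -/
def residual {X Ω : Type*} {t : ℕ} (k : X → X → ℝ) (σ : ℝ) (f : X → Ω → ℝ) (e : Fin t → Ω → ℝ)
    (a : Fin t → X) (z : X) (ω : Ω) : ℝ :=
  f z ω - postWeights k σ a z ⬝ᵥ obs f e a ω

lemma postMean_eq {X : Type*} (k : X → X → ℝ) (σ : ℝ) {t : ℕ} (a : Fin t → X) (y : Fin t → ℝ)
    (z : X) : postMean k σ (fun i => (a i, y i)) z = postWeights k σ a z ⬝ᵥ y := by
  simp only [postMean, postWeights, Matrix.dotProduct_mulVec]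

/-- Posterior variance at `z` after queries at `a`. -/
def condVar {X : Type*} (k : X → X → ℝ) (σ : ℝ) {t : ℕ} (a : Fin t → X) (z : X) : ℝ :=
  k z z - postWeights k σ a z ⬝ᵥ kernelVec k a z

lemma postVar_eq {X : Type*} (k : X → X → ℝ) (σ : ℝ) {t : ℕ} (D : Fin t → X × ℝ) (z : X) :
    postVar k σ D z = condVar k σ (fun i => (D i).1) z := by
  simp only [postVar, condVar, postWeights, Matrix.dotProduct_mulVec]

section Posterior

variable {X Ω : Type*} [MeasurableSpace Ω] {P : Measure Ω}
  {t : ℕ} {k : X → X → ℝ} {σ : ℝ} {f : X → Ω → ℝ} {e : Fin t → Ω → ℝ}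

lemma posDef_noisyKernelMatrix (hk : (Matrix.of k).PosSemidef) (hσ : 0 < σ) (a : Fin t → X) :
    (kernelMatrix k a + σ ^ 2 • (1 : Matrix (Fin t) (Fin t) ℝ)).PosDef :=
  Matrix.PosDef.posSemidef_add (hk.submatrix a) (Matrix.PosDef.one.smul (by positivity))

/-- The normal equations of linear prediction, which make the residual uncorrelated with every
observation. -/
lemma postWeights_vecMul (hk : (Matrix.of k).PosSemidef) (hσ : 0 < σ) (a : Fin t → X) (z : X) :
    postWeights k σ a z ᵥ* (kernelMatrix k a + σ ^ 2 • (1 : Matrix (Fin t) (Fin t) ℝ)) =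
      kernelVec k a z := by
  have h := (posDef_noisyKernelMatrix hk hσ a).isUnit
  rw [postWeights, Matrix.vecMul_vecMul,
    Matrix.nonsing_inv_mul _ ((Matrix.isUnit_iff_isUnit_det _).1 h),
    Matrix.vecMul_one]

/-- The subtracted term is a quadratic form of a positive definite inverse. With `k z z ≤ 1` this
keeps posterior variances in `[0, 1]`, as the logarithmic bound needs. -/
lemma condVar_le (hk : (Matrix.of k).PosSemidef) (hσ : 0 < σ) (a : Fin t → X) (z : X) :
    condVar k σ a z ≤ k z z := by
  have h := (posDef_noisyKernelMatrix hk hσ a).inv.posSemidef.dotProduct_mulVec_nonneg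
    (kernelVec k a z)
  simp only [condVar, postWeights, ← Matrix.dotProduct_mulVec]
  simpa using h

namespace IsNoisyGP

lemma isProbabilityMeasure (h : IsNoisyGP k σ f e P) : IsProbabilityMeasure P :=
  (IsGPSample.isGaussianProcess h.gp).isProbabilityMeasure

lemma hasGaussianLaw_prodMk [Fintype X] (h : IsNoisyGP k σ f e P) :
    HasGaussianLaw (fun ω => ((fun x => f x ω), (fun i => e i ω))) P := by
  refine IndepFun.hasGaussianLaw ?_ ?_ h.indep
  · have h1 := (IsGPSample.isGaussianProcess h.gp).hasGaussianLaw (Finset.univ : Finset X)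
    -- A Gaussian process provides laws on finite index sets; `L` reindexes the one on `univ` by
    -- `X`.
    let L : (↥(Finset.univ : Finset X) → ℝ) →L[ℝ] (X → ℝ) := ContinuousLinearMap.pi fun x =>
      ContinuousLinearMap.proj (R := ℝ) (φ := fun _ : ↥(Finset.univ : Finset X) => ℝ)
        ⟨x, Finset.mem_univ x⟩
    exact h1.map_fun L
  · exact h.noise_indep.hasGaussianLaw fun i => (h.noise_law i).hasGaussianLaw

lemma hasGaussianLaw_linear [Fintype X] (h : IsNoisyGP k σ f e P) {E : Type*}
    [NormedAddCommGroup E] [NormedSpace ℝ E]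
    [MeasurableSpace E] [BorelSpace E] (L : ((X → ℝ) × (Fin t → ℝ)) →L[ℝ] E) :
    HasGaussianLaw (fun ω => L ((fun x => f x ω), (fun i => e i ω))) P :=
  h.hasGaussianLaw_prodMk.map_fun L

lemma memLp_f (h : IsNoisyGP k σ f e P) (x : X) : MemLp (f x) 2 P :=
  ((IsGPSample.isGaussianProcess h.gp).hasGaussianLaw_eval x).memLp_two

lemma memLp_noise (h : IsNoisyGP k σ f e P) (i : Fin t) : MemLp (e i) 2 P :=
  (h.noise_law i).hasGaussianLaw.memLp_two

lemma memLp_obs (h : IsNoisyGP k σ f e P) (a : Fin t → X) (i : Fin t) : MemLp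
    (fun ω => obs f e a ω i) 2 P :=
  (h.memLp_f (a i)).add (h.memLp_noise i)

lemma measurable_obs (h : IsNoisyGP k σ f e P) (a : Fin t → X) : Measurable (obs f e a) :=
  measurable_pi_lambda _ fun i => (h.gp.measurable (a i)).add (h.noise_measurable i)

lemma measurable_residual (h : IsNoisyGP k σ f e P) (a : Fin t → X) (z : X) : Measurable
    (residual k σ f e a z) := by
  have h1 := h.measurable_obs a
  have h2 := h.gp.measurable z
  unfold residual dotProduct
  fun_prop

lemma memLp_residual (h : IsNoisyGP k σ f e P) (a : Fin t → X) (z : X) : MemLp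
    (residual k σ f e a z) 2 P := by
  refine (h.memLp_f z).sub ?_
  simp only [dotProduct]
  exact memLp_finsetSum _ fun i _ => (h.memLp_obs a i).const_mul _

lemma integral_noise (h : IsNoisyGP k σ f e P) (i : Fin t) : ∫ ω, e i ω ∂P = 0 := by
  simpa using (h.noise_law i).integral_eq

lemma integral_obs (h : IsNoisyGP k σ f e P) (a : Fin t → X) (i : Fin t) :
    ∫ ω, obs f e a ω i ∂P = 0 := by
  have := h.isProbabilityMeasure
  simp only [obs]
  rw [integral_add ((h.memLp_f _).integrable one_le_two) ((h.memLp_noise i).integrable one_le_two),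
    h.integral_noise, h.gp.mean_eq_zero, add_zero]

lemma integral_residual (h : IsNoisyGP k σ f e P) (a : Fin t → X) (z : X) :
    ∫ ω, residual k σ f e a z ω ∂P = 0 := by
  have := h.isProbabilityMeasure
  have h1 : ∀ i, Integrable (fun ω => postWeights k σ a z i * obs f e a ω i) P :=
    fun i => ((h.memLp_obs a i).integrable one_le_two).const_mul _
  simp only [residual, dotProduct]
  rw [integral_sub ((h.memLp_f _).integrable one_le_two) (integrable_finsetSum _ fun i _ => h1 i),
    integral_finsetSum _ fun i _ => h1 i, h.gp.mean_eq_zero]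
  simp [integral_const_mul, h.integral_obs]

lemma covariance_f_noise (h : IsNoisyGP k σ f e P) (x : X) (i : Fin t) : cov[f x, e i; P] = 0 := by
  have h1 : IndepFun (f x) (e i) P :=
    h.indep.comp (measurable_pi_apply x) (measurable_pi_apply i)
  exact h1.covariance_eq_zero (h.memLp_f x) (h.memLp_noise i)

lemma variance_noise (h : IsNoisyGP k σ f e P) (i : Fin t) : Var[e i; P] = σ ^ 2 := by
  rw [(h.noise_law i).variance_eq, variance_id_gaussianReal, Real.coe_toNNReal _ (sq_nonneg σ)]

lemma covariance_noise (h : IsNoisyGP k σ f e P) (i j : Fin t) :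
    cov[e i, e j; P] = if i = j then σ ^ 2 else 0 := by
  split_ifs with hij
  · subst hij
    rw [covariance_self (h.noise_measurable i).aemeasurable, h.variance_noise]
  · exact (h.noise_indep.indepFun hij).covariance_eq_zero (h.memLp_noise i) (h.memLp_noise j)

lemma covariance_f_obs (h : IsNoisyGP k σ f e P) (a : Fin t → X) (z : X) (j : Fin t) :
    cov[f z, fun ω => obs f e a ω j; P] = k z (a j) := by
  have := h.isProbabilityMeasure
  have h1 := covariance_add_right (h.memLp_f z) (h.memLp_f (a j)) (h.memLp_noise j)
  rw [h.covariance_f_noise, add_zero, h.gp.covariance_eq] at h1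
  exact h1

lemma covariance_noise_obs (h : IsNoisyGP k σ f e P) (a : Fin t → X) (i j : Fin t) :
    cov[e i, fun ω => obs f e a ω j; P] = if i = j then σ ^ 2 else 0 := by
  have := h.isProbabilityMeasure
  have h1 := covariance_add_right (h.memLp_noise i) (h.memLp_f (a j)) (h.memLp_noise j)
  rw [covariance_comm (e i) (f (a j)), h.covariance_f_noise, zero_add, h.covariance_noise] at h1
  exact h1

lemma covariance_obs (h : IsNoisyGP k σ f e P) (a : Fin t → X) (i j : Fin t) :
    cov[fun ω => obs f e a ω i, fun ω => obs f e a ω j; P] =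
      (kernelMatrix k a + σ ^ 2 • (1 : Matrix (Fin t) (Fin t) ℝ)) i j := by
  have := h.isProbabilityMeasure
  have h1 := covariance_add_left (h.memLp_f (a i)) (h.memLp_noise i) (h.memLp_obs a j)
  rw [h.covariance_f_obs, h.covariance_noise_obs] at h1
  refine h1.trans ?_
  simp [kernelMatrix, Matrix.one_apply]

lemma covariance_residual_left (h : IsNoisyGP k σ f e P) (a : Fin t → X) (z : X) {W : Ω → ℝ}
    (hW : MemLp W 2 P) :
    cov[residual k σ f e a z, W; P] =
      cov[f z, W; P] - ∑ i, postWeights k σ a z i * cov[fun ω => obs f e a ω i, W; P] := by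
  have := h.isProbabilityMeasure
  have h1 : ∀ i, MemLp (fun ω => postWeights k σ a z i * obs f e a ω i) 2 P :=
    fun i => (h.memLp_obs a i).const_mul _
  have h2 : residual k σ f e a z =
      fun ω => f z ω - ∑ i, postWeights k σ a z i * obs f e a ω i := rfl
  rw [h2, covariance_fun_sub_left (h.memLp_f z) (memLp_finsetSum _ fun i _ => h1 i) hW,
    covariance_fun_sum_left h1 hW]
  simp only [covariance_const_mul_left]

lemma covariance_residual_obs (h : IsNoisyGP k σ f e P) (hk : (Matrix.of k).PosSemidef) (hσ : 0 < σ)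
    (a : Fin t → X) (z : X) (j : Fin t) :
    cov[residual k σ f e a z, fun ω => obs f e a ω j; P] = 0 := by
  rw [h.covariance_residual_left a z (h.memLp_obs a j), h.covariance_f_obs]
  simp only [h.covariance_obs]
  have h1 := congrFun (postWeights_vecMul hk hσ a z) j
  simp only [Matrix.vecMul, dotProduct, kernelVec] at h1
  rw [h1, sub_self]

/-- The residual is uncorrelated with the observations, so its variance equals its covariance with
`f z`. -/
lemma variance_residual (h : IsNoisyGP k σ f e P) (hk : (Matrix.of k).PosSemidef) (hσ : 0 < σ)
    (a : Fin t → X) (z : X) :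
    Var[residual k σ f e a z; P] = condVar k σ a z := by
  have := h.isProbabilityMeasure
  have h0 : ∀ i, cov[fun ω => obs f e a ω i, residual k σ f e a z; P] = 0 := fun i => by
    rw [covariance_comm, h.covariance_residual_obs hk hσ]
  rw [← covariance_self (h.measurable_residual a z).aemeasurable,
    h.covariance_residual_left a z (h.memLp_residual a z), covariance_comm,
    h.covariance_residual_left a z (h.memLp_f z), h.gp.covariance_eq]
  simp only [h0, mul_zero, Finset.sum_const_zero, sub_zero, condVar, dotProduct, kernelVec]
  congr 1
  refine Finset.sum_congr rfl fun i _ => ?_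
  rw [covariance_comm, h.covariance_f_obs]

lemma condVar_nonneg (h : IsNoisyGP k σ f e P) (hk : (Matrix.of k).PosSemidef) (hσ : 0 < σ)
    (a : Fin t → X) (z : X) :
    0 ≤ condVar k σ a z := by
  rw [← h.variance_residual hk hσ a z]
  exact variance_nonneg _ _

lemma hasGaussianLaw_residual_obs [Fintype X] (h : IsNoisyGP k σ f e P) (a : Fin t → X) :
    HasGaussianLaw (fun ω => ((fun z => residual k σ f e a z ω), (fun i => obs f e a ω i))) P := by
  let pf := ContinuousLinearMap.fst ℝ (X → ℝ) (Fin t → ℝ)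
  let pe := ContinuousLinearMap.snd ℝ (X → ℝ) (Fin t → ℝ)
  let O : ((X → ℝ) × (Fin t → ℝ)) →L[ℝ] (Fin t → ℝ) := ContinuousLinearMap.pi fun i =>
    (ContinuousLinearMap.proj (R := ℝ) (φ := fun _ => ℝ) (a i)).comp pf +
      (ContinuousLinearMap.proj (R := ℝ) (φ := fun _ => ℝ) i).comp pe
  let R : ((X → ℝ) × (Fin t → ℝ)) →L[ℝ] (X → ℝ) := ContinuousLinearMap.pi fun z =>
    (ContinuousLinearMap.proj (R := ℝ) (φ := fun _ => ℝ) z).comp pf -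
      ∑ i, postWeights k σ a z i •
        (ContinuousLinearMap.proj (R := ℝ) (φ := fun _ => ℝ) i).comp O
  refine (h.hasGaussianLaw_linear (R.prod O)).congr (ae_of_all _ fun ω => ?_)
  ext
  · simp [R, O, pf, pe, residual, obs, dotProduct, mul_add]
  · simp [O, pf, pe, obs]

/-- Jointly Gaussian and uncorrelated vectors are independent. This stands in for the Gaussian
posterior law: `f` is the posterior mean plus an independent residual. -/
lemma indepFun_residual_obs [Fintype X] (h : IsNoisyGP k σ f e P) (hk : (Matrix.of k).PosSemidef)
    (hσ : 0 < σ) (a : Fin t → X) :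
    IndepFun (fun ω z => residual k σ f e a z ω) (obs f e a) P :=
  (h.hasGaussianLaw_residual_obs a).indepFun_of_covariance_eval
    fun z j => h.covariance_residual_obs hk hσ a z j

lemma map_residual [Fintype X] (h : IsNoisyGP k σ f e P) (hk : (Matrix.of k).PosSemidef)
    (hσ : 0 < σ) (a : Fin t → X) (z : X) :
    P.map (residual k σ f e a z) = gaussianReal 0 (condVar k σ a z).toNNReal := by
  have h1 : HasGaussianLaw (residual k σ f e a z) P :=
    (h.hasGaussianLaw_residual_obs (k := k) (σ := σ) a).fst.eval z
  rw [h1.map_eq_gaussianReal, h.integral_residual, h.variance_residual hk hσ]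

end IsNoisyGP

end Posterior

/-! ### Gaussian tails and the shifted exponential distribution -/

/-- By symmetry the two open half lines have equal mass; for `v = 0` both are null. -/
lemma gaussianReal_Ioi_zero_le (v : NNReal) :
    gaussianReal 0 v (Set.Ioi 0) ≤ ENNReal.ofReal (1 / 2) := by
  have h1 : gaussianReal 0 v (Set.Iio 0) = gaussianReal 0 v (Set.Ioi 0) := by
    have h2 := gaussianReal_map_neg (μ := 0) (v := v)
    rw [neg_zero] at h2
    conv_rhs => rw [← h2]
    rw [Measure.map_apply measurable_neg measurableSet_Ioi]
    congr 1
    ext y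
    simp
  have h3 : gaussianReal 0 v (Set.Ioi 0) + gaussianReal 0 v (Set.Ioi 0) ≤ 1 := by
    nth_rewrite 1 [← h1]
    rw [← measure_union (by
      exact Set.disjoint_left.2 fun y hy hy' => lt_asymm (Set.mem_Iio.1 hy)
        (Set.mem_Ioi.1 hy')) measurableSet_Ioi]
    exact prob_le_one
  rw [← two_mul] at h3
  rw [one_div, ENNReal.ofReal_inv_of_pos two_pos, ENNReal.ofReal_ofNat]
  rwa [ENNReal.le_inv_iff_mul_le, mul_comm]

/-- Gaussian tail bound with the sharp constant `1 / 2`. -/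
lemma gaussianReal_Ioi_le {v : NNReal} (hv : v ≠ 0) {u : ℝ} (hu : 0 ≤ u) :
    gaussianReal 0 v (Set.Ioi u) ≤ ENNReal.ofReal (1 / 2 * Real.exp (-(u ^ 2 / (2 * v)))) := by
  have hv' : (0 : ℝ) < v := by positivity
  -- For `y, u ≥ 0`, `(y + u)² ≥ y² + u²`. After translating by `u` the exponential factors out, and
  -- what is left is the mass of a half line, the source of `1 / 2`.
  have h1 : ∀ y ∈ Set.Ioi (0 : ℝ), gaussianPDF 0 v (y + u) ≤
      ENNReal.ofReal (Real.exp (-(u ^ 2 / (2 * v)))) * gaussianPDF 0 v y := by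
    intro y hy
    rw [gaussianPDF, gaussianPDF, ← ENNReal.ofReal_mul (Real.exp_nonneg _)]
    refine ENNReal.ofReal_le_ofReal ?_
    rw [gaussianPDFReal, gaussianPDFReal, mul_left_comm, ← Real.exp_add]
    refine mul_le_mul_of_nonneg_left (Real.exp_le_exp.2 ?_) (by positivity)
    rw [← neg_div, ← add_div]
    refine div_le_div_of_nonneg_right ?_ (by positivity)
    nlinarith [mul_nonneg hu (le_of_lt (Set.mem_Ioi.1 hy))]
  calc gaussianReal 0 v (Set.Ioi u) = ∫⁻ y, (Set.Ioi u).indicator (gaussianPDF 0 v) y := by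
        rw [gaussianReal_apply 0 hv, lintegral_indicator measurableSet_Ioi]
    _ = ∫⁻ y, (Set.Ioi u).indicator (gaussianPDF 0 v) (y + u) :=
        (lintegral_add_right_eq_self _ u).symm
    _ = ∫⁻ y, (Set.Ioi 0).indicator (fun y => gaussianPDF 0 v (y + u)) y := by
        congr with y
        simp [Set.indicator_apply]
    _ = ∫⁻ y in Set.Ioi 0, gaussianPDF 0 v (y + u) := lintegral_indicator measurableSet_Ioi _
    _ ≤ ∫⁻ y in Set.Ioi 0,
          ENNReal.ofReal (Real.exp (-(u ^ 2 / (2 * v)))) * gaussianPDF 0 v y :=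
        setLIntegral_mono' measurableSet_Ioi h1
    _ = ENNReal.ofReal (Real.exp (-(u ^ 2 / (2 * v)))) * gaussianReal 0 v (Set.Ioi 0) := by
        rw [lintegral_const_mul _ (measurable_gaussianPDF 0 v), gaussianReal_apply 0 hv]
    _ ≤ ENNReal.ofReal (Real.exp (-(u ^ 2 / (2 * v)))) * ENNReal.ofReal (1 / 2) := by
        gcongr
        exact gaussianReal_Ioi_zero_le v
    _ = _ := by rw [← ENNReal.ofReal_mul (Real.exp_nonneg _), mul_comm]

lemma lintegral_Ioi_exp_neg_mul {r : ℝ} (hr : 0 < r) (q : ℝ) :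
    ∫⁻ z in Set.Ioi q, ENNReal.ofReal (Real.exp (-r * z)) =
      ENNReal.ofReal (Real.exp (-r * q) / r) := by
  rw [← ofReal_integral_eq_lintegral_ofReal (exp_neg_integrableOn_Ioi q hr)
    (ae_of_all _ fun _ => Real.exp_nonneg _), integral_exp_mul_Ioi (by linarith)]
  congr 1
  rw [neg_div_neg_eq]

lemma shiftedExpMeasure_Ioi {s r q : ℝ} (hr : 0 < r) (hq : s ≤ q) :
    shiftedExpMeasure s r (Set.Ioi q) = ENNReal.ofReal (Real.exp (-(r * (q - s)))) := by
  rw [shiftedExpMeasure, withDensity_apply _ measurableSet_Ioi]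
  have h1 : ∀ z ∈ Set.Ioi q, ENNReal.ofReal (shiftedExpPDFReal s r z) =
      ENNReal.ofReal (r * Real.exp (r * s)) * ENNReal.ofReal (Real.exp (-r * z)) := by
    intro z hz
    rw [shiftedExpPDFReal, if_pos (hq.trans (le_of_lt hz)), ← ENNReal.ofReal_mul (by positivity),
      mul_assoc, ← Real.exp_add]
    ring_nf
  rw [setLIntegral_congr_fun measurableSet_Ioi h1, lintegral_const_mul' _ _ ENNReal.ofReal_ne_top,
    lintegral_Ioi_exp_neg_mul hr, ← ENNReal.ofReal_mul (by positivity)]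
  congr 1
  rw [mul_div_assoc', mul_assoc, ← Real.exp_add, mul_div_cancel_left₀ _ hr.ne']
  ring_nf

lemma shiftedExpMeasure_Iio (s r : ℝ) : shiftedExpMeasure s r (Set.Iio s) = 0 := by
  rw [shiftedExpMeasure, withDensity_apply _ measurableSet_Iio]
  refine (setLIntegral_congr_fun measurableSet_Iio (g := fun _ => 0) fun z hz => ?_).trans
    lintegral_zero
  simp [shiftedExpPDFReal, not_le.2 (Set.mem_Iio.1 hz)]

section ShiftedExp

variable {Ω : Type*} [MeasurableSpace Ω] {P : Measure Ω} {s r : ℝ}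
  {Z : Ω → ℝ}

lemma shift_le_ae (hZ : HasLaw Z (shiftedExpMeasure s r) P) : ∀ᵐ ω ∂P, s ≤ Z ω := by
  have h1 := hZ.measure_eq (p := fun z => z < s) measurableSet_Iio
  rw [ae_iff]
  simp only [not_le]
  exact h1.trans (shiftedExpMeasure_Iio s r)

lemma lintegral_sub_shift (hr : 0 < r) (hZ : HasLaw Z (shiftedExpMeasure s r) P) :
    ∫⁻ ω, ENNReal.ofReal (Z ω - s) ∂P = ENNReal.ofReal r⁻¹ := by
  rw [lintegral_eq_lintegral_meas_lt P
    ((shift_le_ae hZ).mono fun ω hω => sub_nonneg.2 hω) (hZ.aemeasurable.sub_const s)]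
  have h1 : ∀ u ∈ Set.Ioi (0 : ℝ), P {ω | u < Z ω - s} = ENNReal.ofReal (Real.exp (-r * u)) := by
    intro u hu
    have h2 := hZ.measure_eq (p := fun z => u < z - s) (by measurability)
    have h3 : {z : ℝ | u < z - s} = Set.Ioi (s + u) := by
      ext z; simp only [Set.mem_ofPred_eq, Set.mem_Ioi]; constructor <;> intro h <;> linarith
    rw [h2, h3, shiftedExpMeasure_Ioi hr (by linarith [Set.mem_Ioi.1 hu])]
    congr 2
    ring
  rw [setLIntegral_congr_fun measurableSet_Ioi h1, lintegral_Ioi_exp_neg_mul hr]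
  simp

lemma integrable_of_shiftedExp [IsProbabilityMeasure P] (hr : 0 < r)
    (hZ : HasLaw Z (shiftedExpMeasure s r) P) :
    Integrable Z P := by
  have h1 : Integrable (fun ω => Z ω - s) P := by
    rw [← lintegral_ofReal_ne_top_iff_integrable
      (hZ.aemeasurable.sub_const s).aestronglyMeasurable
      ((shift_le_ae hZ).mono fun ω hω => sub_nonneg.2 hω), lintegral_sub_shift hr hZ]
    exact ENNReal.ofReal_ne_top
  exact (h1.add (integrable_const s)).congr (ae_of_all _ fun ω => sub_add_cancel _ _)

lemma integral_of_shiftedExp [IsProbabilityMeasure P] (hr : 0 < r)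
    (hZ : HasLaw Z (shiftedExpMeasure s r) P) :
    ∫ ω, Z ω ∂P = s + r⁻¹ := by
  have hi := integrable_of_shiftedExp hr hZ
  have h1 : ∫ ω, (Z ω - s) ∂P = r⁻¹ := by
    rw [integral_eq_lintegral_of_nonneg_ae
      ((shift_le_ae hZ).mono fun ω hω => sub_nonneg.2 hω)
      (hZ.aemeasurable.sub_const s).aestronglyMeasurable, lintegral_sub_shift hr hZ,
      ENNReal.toReal_ofReal (by positivity)]
  rw [integral_sub hi (integrable_const s)] at h1
  simp only [integral_const, probReal_univ, smul_eq_mul, one_mul] at h1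
  linarith

end ShiftedExp

/-! ### Finite suprema -/

section Sup

variable {X Ω : Type*} [Fintype X] [Nonempty X] [MeasurableSpace Ω] {P : Measure Ω}

lemma abs_iSup_le_sum (g : X → ℝ) : |⨆ z, g z| ≤ ∑ z, |g z| := by
  have h1 : ∀ z, |g z| ≤ ∑ z, |g z| := fun z =>
    Finset.single_le_sum (fun i _ => abs_nonneg (g i)) (Finset.mem_univ z)
  obtain ⟨z₀⟩ := ‹Nonempty X›
  rw [abs_le]
  refine ⟨?_, ciSup_le fun z => (le_abs_self _).trans (h1 z)⟩
  exact (neg_le_of_abs_le (h1 z₀)).trans (le_ciSup (Set.finite_range g).bddAbove z₀)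

lemma integrable_iSup {g : X → Ω → ℝ} (hg : ∀ z, Integrable (g z) P) :
    Integrable (fun ω => ⨆ z, g z ω) P := by
  refine (integrable_finsetSum Finset.univ fun z _ => (hg z).abs).mono'
    (AEMeasurable.iSup fun z => (hg z).aemeasurable).aestronglyMeasurable
    (ae_of_all _ fun ω => ?_)
  exact abs_iSup_le_sum fun z => g z ω

end Sup

/-! ### Comparison of the posterior maximum and the randomized upper confidence bound -/

/-- If the lower bound `c` of `B` and all upper tails of `A` above `c` are dominated by those of
`B`, then `A` has a smaller expectation than `B`. -/
lemma integral_le_integral_of_tail_le {Ω : Type*} [MeasurableSpace Ω] {P : Measure Ω}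
    [IsProbabilityMeasure P] {A B : Ω → ℝ} (hA : Integrable A P) (hB : Integrable B P) {c : ℝ}
    (hc : ∀ᵐ ω ∂P, c ≤ B ω) (h : ∀ v, c ≤ v → P {ω | v < A ω} ≤ P {ω | v < B ω}) :
    ∫ ω, A ω ∂P ≤ ∫ ω, B ω ∂P := by
  -- Layer cake applied to `(A - c)⁺` and `B - c`; both are nonnegative, and only levels above `c`
  -- enter.
  have hA' : Integrable (fun ω => max (A ω - c) 0) P := (hA.sub (integrable_const c)).pos_part
  have hB' : Integrable (fun ω => B ω - c) P := hB.sub (integrable_const c)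
  have h0 : 0 ≤ᵐ[P] fun ω => B ω - c := hc.mono fun ω hω => sub_nonneg.2 hω
  have h0' : 0 ≤ᵐ[P] fun ω => max (A ω - c) 0 := ae_of_all _ fun ω => le_max_right _ _
  have h1 : ∫⁻ ω, ENNReal.ofReal (max (A ω - c) 0) ∂P ≤ ∫⁻ ω, ENNReal.ofReal (B ω - c) ∂P := by
    rw [lintegral_eq_lintegral_meas_lt P h0' hA'.aemeasurable,
      lintegral_eq_lintegral_meas_lt P h0 hB'.aemeasurable]
    refine setLIntegral_mono' measurableSet_Ioi fun u hu => ?_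
    have hu : 0 < u := hu
    have e1 : {ω | u < max (A ω - c) 0} = {ω | c + u < A ω} := by
      ext ω
      simp only [Set.mem_ofPred_eq, lt_max_iff, not_lt.2 hu.le, or_false]
      constructor <;> intro h <;> linarith
    have e2 : {ω | u < B ω - c} = {ω | c + u < B ω} := by
      ext ω; simp only [Set.mem_ofPred_eq]; constructor <;> intro h <;> linarith
    rw [e1, e2]
    exact h _ (by linarith)
  have h2 : ∫ ω, max (A ω - c) 0 ∂P ≤ ∫ ω, (B ω - c) ∂P := by
    rw [integral_eq_lintegral_of_nonneg_ae h0' hA'.aestronglyMeasurable,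
      integral_eq_lintegral_of_nonneg_ae h0 hB'.aestronglyMeasurable]
    refine ENNReal.toReal_mono ?_ h1
    exact (lintegral_ofReal_ne_top_iff_integrable hB'.aestronglyMeasurable h0).2 hB'
  have h3 : ∫ ω, (A ω - c) ∂P ≤ ∫ ω, max (A ω - c) 0 ∂P :=
    integral_mono (hA.sub (integrable_const c)) hA' fun ω => le_max_left _ _
  have h4 := h3.trans h2
  rw [integral_sub hA (integrable_const c), integral_sub hB (integrable_const c)] at h4
  linarith

lemma integrable_sqrt_of_integrable {Ω : Type*} [MeasurableSpace Ω] {P : Measure Ω}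
    [IsProbabilityMeasure P] {Z : Ω → ℝ} (hZ : Integrable Z P) : Integrable (fun ω => √(Z ω)) P :=
      by
  refine ((integrable_const 1).add hZ.abs).mono'
    (Real.continuous_sqrt.measurable.comp_aemeasurable hZ.aemeasurable).aestronglyMeasurable
    (ae_of_all _ fun ω => ?_)
  rw [Real.norm_of_nonneg (Real.sqrt_nonneg _)]
  refine (Real.sqrt_le_sqrt (le_abs_self (Z ω))).trans ?_
  simp only [Pi.add_apply]
  rw [Real.sqrt_le_left (by positivity)]
  nlinarith [abs_nonneg (Z ω)]

/-- The expected maximum of Gaussian variables is at most the expected maximum of their upper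
confidence bounds when the confidence parameter has the shifted exponential distribution. -/
lemma integral_iSup_le_of_shiftedExp {X Ω : Type*} [Fintype X] [Nonempty X] [MeasurableSpace Ω]
    {P : Measure Ω} [IsProbabilityMeasure P] {R : X → Ω → ℝ} (m v : X → ℝ)
    (hR : ∀ z, Measurable (R z)) (hRlaw : ∀ z, P.map (R z) = gaussianReal 0 (v z).toNNReal)
    {Z : Ω → ℝ} (hX : 2 ≤ Fintype.card X)
    (hZ : HasLaw Z (shiftedExpMeasure (2 * Real.log ((Fintype.card X : ℝ) / 2)) (1 / 2)) P) :
    ∫ ω, ⨆ z, (m z + R z ω) ∂P ≤ ∫ ω, ⨆ z, (m z + √(Z ω) * √(v z)) ∂P := by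
  set s := 2 * Real.log ((Fintype.card X : ℝ) / 2) with hs
  have hX' : (2 : ℝ) ≤ Fintype.card X := by exact_mod_cast hX
  have hs0 : 0 ≤ s := mul_nonneg two_pos.le (Real.log_nonneg (by linarith))
  have hbdd : ∀ g : X → ℝ, BddAbove (Set.range g) := fun g => (Set.finite_range g).bddAbove
  have hRi : ∀ z, Integrable (R z) P := fun z =>
    (HasGaussianLaw.mk (X := R z) (by rw [hRlaw z]; infer_instance)).integrable
  have hZi := integrable_sqrt_of_integrable (integrable_of_shiftedExp (by norm_num) hZ)
  -- `c` is the maximal confidence bound at the smallest parameter `ζ = s`, hence an almost sure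
  -- lower bound of the right side.
  refine integral_le_integral_of_tail_le (c := ⨆ z, (m z + √s * √(v z)))
    (integrable_iSup fun z => (integrable_const _).add (hRi z))
    (integrable_iSup fun z => (integrable_const _).add (hZi.mul_const _)) ?_ ?_
  · filter_upwards [shift_le_ae hZ] with ω hω
    refine ciSup_mono (hbdd _) fun z => ?_
    gcongr
  intro u hu
  have hmu : ∀ z, m z + √s * √(v z) ≤ u := fun z => (le_ciSup (hbdd _) z).trans hu
  have hunion : {ω | u < ⨆ z, (m z + R z ω)} ⊆ ⋃ z, {ω | u - m z < R z ω} := by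
    intro ω hω
    obtain ⟨z, hz⟩ := exists_lt_of_lt_ciSup (show u < ⨆ z, (m z + R z ω) from hω)
    exact Set.mem_iUnion.2 ⟨z, by simp only [Set.mem_ofPred_eq]; linarith⟩
  have htail : ∀ z, P {ω | u - m z < R z ω} = gaussianReal 0 (v z).toNNReal (Set.Ioi (u - m z)) :=
    fun z => by rw [← hRlaw z, Measure.map_apply (hR z) measurableSet_Ioi]; rfl
  have hum : ∀ z, 0 ≤ u - m z := fun z => by
    have := hmu z
    have : 0 ≤ √s * √(v z) := by positivity
    linarith
  have hzero : ∀ z, v z ≤ 0 → P {ω | u - m z < R z ω} = 0 := fun z hz => by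
    rw [htail, Real.toNNReal_of_nonpos hz, gaussianReal_zero_var,
      Measure.dirac_apply' _ measurableSet_Ioi]
    simpa using hum z
  -- If every variance vanishes there is no minimiser below, but then the left tail event is null.
  by_cases hv : ∃ z, 0 < v z
  swap
  · push Not at hv
    refine (measure_mono hunion).trans ((measure_iUnion_le _).trans ?_)
    simp [hzero _ (hv _)]
  -- `q z` is the value of `ζ` at which the confidence bound of `z` reaches `u`.
  let q : X → ℝ := fun z => (u - m z) ^ 2 / v z
  obtain ⟨z₀, hz₀, hmin⟩ := (Finset.univ.filter fun z => 0 < v z).exists_min_image q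
    (by obtain ⟨z, hz⟩ := hv; exact ⟨z, by simpa using hz⟩)
  simp only [Finset.mem_filter, Finset.mem_univ, true_and] at hz₀ hmin
  -- Since `u ≥ c`, the level `q z₀` lies beyond the shift, where the exponential tail formula is
  -- valid.
  have hsq : s ≤ q z₀ := by
    rw [le_div_iff₀ hz₀]
    have h1 : √s * √(v z₀) ≤ u - m z₀ := by linarith [hmu z₀]
    calc s * v z₀ = (√s * √(v z₀)) ^ 2 := by
          rw [mul_pow, Real.sq_sqrt hs0, Real.sq_sqrt hz₀.le]
      _ ≤ (u - m z₀) ^ 2 := by gcongr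
  have hA : P {ω | u < ⨆ z, (m z + R z ω)} ≤
      ENNReal.ofReal (Fintype.card X * (1 / 2 * Real.exp (-(q z₀ / 2)))) := by
    calc P {ω | u < ⨆ z, (m z + R z ω)} ≤ ∑ z, P {ω | u - m z < R z ω} :=
          (measure_mono hunion).trans (measure_iUnion_fintype_le _ _)
      _ ≤ ∑ _z : X, ENNReal.ofReal (1 / 2 * Real.exp (-(q z₀ / 2))) := by
          refine Finset.sum_le_sum fun z _ => ?_
          rcases le_or_gt (v z) 0 with hz | hz
          · rw [hzero z hz]; exact zero_le
          rw [htail]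
          refine (gaussianReal_Ioi_le (by simpa using hz) (hum z)).trans
            (ENNReal.ofReal_le_ofReal ?_)
          rw [Real.coe_toNNReal _ hz.le]
          have h2 : (u - m z) ^ 2 / (2 * v z) = q z / 2 := by
            simp only [q]; rw [div_div, mul_comm (2 : ℝ)]
          rw [h2]
          have h3 := hmin z hz
          gcongr
      _ = _ := by
          rw [Finset.sum_const, Finset.card_univ, nsmul_eq_mul,
            ENNReal.ofReal_mul (Nat.cast_nonneg _), ENNReal.ofReal_natCast]
  -- Here `exp (s / 2) = |X| / 2` absorbs the union bound and the Gaussian constant, so the two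
  -- estimates match exactly.
  have hB : P {ω | q z₀ < Z ω} =
      ENNReal.ofReal (Fintype.card X * (1 / 2 * Real.exp (-(q z₀ / 2)))) := by
    have h1 := hZ.measure_eq (p := fun z => q z₀ < z) measurableSet_Ioi
    refine h1.trans ((shiftedExpMeasure_Ioi (by norm_num) hsq).trans ?_)
    congr 1
    have h2 : -(1 / 2 * (q z₀ - s)) = Real.log ((Fintype.card X : ℝ) / 2) + -(q z₀ / 2) := by
      rw [hs]; ring
    rw [h2, Real.exp_add, Real.exp_log (by positivity)]
    ring
  refine (hA.trans_eq hB.symm).trans (measure_mono fun ω hω => ?_)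
  -- Once `ζ > q z₀`, the single point `z₀` already exceeds `u`.
  refine lt_of_lt_of_le ?_ (le_ciSup (hbdd _) z₀)
  have h1 : u - m z₀ < √(Z ω) * √(v z₀) := by
    have h2 : q z₀ * v z₀ = (u - m z₀) ^ 2 := div_mul_cancel₀ _ hz₀.ne'
    have h3 : (u - m z₀) ^ 2 < Z ω * v z₀ := by
      rw [← h2]; exact mul_lt_mul_of_pos_right hω hz₀
    rw [← Real.sqrt_mul ((hs0.trans hsq).trans (le_of_lt hω))]
    exact Real.lt_sqrt_of_sq_lt h3
  linarith

/-! ### Densities -/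

lemma map_withDensity_of_measurePreserving {α β : Type*} [MeasurableSpace α] [MeasurableSpace β]
    {μ : Measure α} {ν : Measure β} {T : α → β} (hT : MeasurePreserving T μ ν) {p : β → ℝ≥0∞}
    (hp : Measurable p) : (μ.withDensity fun z => p (T z)).map T = ν.withDensity p := by
  ext A hA
  rw [Measure.map_apply hT.measurable hA, withDensity_apply _ (hT.measurable hA),
    withDensity_apply _ hA, hT.setLIntegral_comp_preimage hA hp]

lemma pi_gaussianReal_eq_withDensity {ι : Type*} [Fintype ι] (v : ι → NNReal)
    (hv : ∀ i, v i ≠ 0) :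
    Measure.pi (fun i => gaussianReal 0 (v i)) =
      volume.withDensity fun y : ι → ℝ => ENNReal.ofReal (∏ i, gaussianPDFReal 0 (v i) (y i)) := by
  refine Measure.pi_eq fun A hA => ?_
  rw [withDensity_apply _ (MeasurableSet.univ_pi hA), volume_pi, Measure.restrict_pi_pi,
    ← ofReal_integral_eq_lintegral_ofReal
      (Integrable.fintype_prod fun i => (integrable_gaussianPDFReal 0 (v i)).restrict)
      (ae_of_all _ fun y => Finset.prod_nonneg fun i _ => gaussianPDFReal_nonneg _ _ _),
    integral_fintype_prod_eq_prod (fun i => gaussianPDFReal 0 (v i)),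
    ENNReal.ofReal_prod_of_nonneg
      fun i _ => integral_nonneg fun y => gaussianPDFReal_nonneg _ _ _]
  exact Finset.prod_congr rfl fun i _ => (gaussianReal_apply_eq_integral 0 (hv i) (A i)).symm

lemma log_gaussianPDFReal {v : NNReal} (hv : v ≠ 0) (y : ℝ) :
    Real.log (gaussianPDFReal 0 v y) =
      -(Real.log (2 * Real.pi * v) / 2) - y ^ 2 / (2 * v) := by
  have hv' : (0 : ℝ) < v := by positivity
  rw [gaussianPDFReal, Real.log_mul (by positivity) (Real.exp_ne_zero _), Real.log_inv,
    Real.log_sqrt (by positivity), Real.log_exp, sub_zero]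
  ring

/-- The Kullback–Leibler divergence of two probability measures with positive densities. -/
lemma klDiv_eq_of_density {α : Type*} [MeasurableSpace α] {m J Q : Measure α}
    [IsProbabilityMeasure J] [IsProbabilityMeasure Q] {g q : α → ℝ} (hg : Measurable g)
    (hq : Measurable q) (hg0 : ∀ z, 0 < g z) (hq0 : ∀ z, 0 < q z)
    (hJ : J = m.withDensity fun z => ENNReal.ofReal (g z))
    (hQ : Q = m.withDensity fun z => ENNReal.ofReal (q z))
    (hint : Integrable (fun z => Real.log (g z) - Real.log (q z)) J) :
    InformationTheory.klDiv J Q =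
      ENNReal.ofReal (∫ z, (Real.log (g z) - Real.log (q z)) ∂J) := by
  have hr : Measurable fun z => ENNReal.ofReal (g z / q z) := (hg.div hq).ennreal_ofReal
  have hJQ : J = Q.withDensity fun z => ENNReal.ofReal (g z / q z) := by
    rw [hQ, ← withDensity_mul _ hq.ennreal_ofReal hr, hJ]
    congr with z
    rw [Pi.mul_apply, ← ENNReal.ofReal_mul (hq0 z).le, mul_div_cancel₀ _ (hq0 z).ne']
  have hac : J ≪ Q := by rw [hJQ]; exact withDensity_absolutelyContinuous _ _
  have h1 : J.rnDeriv Q =ᵐ[Q] fun z => ENNReal.ofReal (g z / q z) := by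
    conv_lhs => rw [hJQ]
    exact Measure.rnDeriv_withDensity Q hr
  have h2 : llr J Q =ᵐ[J] fun z => Real.log (g z) - Real.log (q z) := by
    filter_upwards [hac.ae_le h1] with z hz
    rw [llr, hz, ENNReal.toReal_ofReal (div_nonneg (hg0 z).le (hq0 z).le),
      Real.log_div (hg0 z).ne' (hq0 z).ne']
  rw [InformationTheory.klDiv_of_ac_of_integrable hac ((integrable_congr h2).2 hint),
    integral_congr_ae h2]
  -- The term `Q univ - J univ` in `klDiv` vanishes for probability measures.
  simp

/-! ### Innovations -/

/-- The points `a₀, …, a₍ᵢ₋₁₎`. -/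
def prefixPts {X : Type*} {n : ℕ} (a : Fin n → X) (i : Fin n) : Fin i → X :=
  fun j => a (Fin.castLE i.isLt.le j)

/-- The unit lower triangular matrix that maps the observations at `a` to the innovations. -/
def innovationMatrix {X : Type*} (k : X → X → ℝ) (σ : ℝ) {n : ℕ} (a : Fin n → X) :
    Matrix (Fin n) (Fin n) ℝ :=
  Matrix.of fun i j =>
    if h : j < i then -(postWeights k σ (prefixPts a i) (a i) ⟨j, h⟩) else if j = i then 1 else 0

/-- Passing to innovations preserves Lebesgue measure, so no Jacobian enters the density of the
observations. -/
lemma det_innovationMatrix {X : Type*} (k : X → X → ℝ) (σ : ℝ) {n : ℕ} (a : Fin n → X) :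
    (innovationMatrix k σ a).det = 1 := by
  rw [Matrix.det_of_isLowerTriangular]
  · simp [innovationMatrix]
  · intro i j hij
    have hij : i < j := hij
    simp [innovationMatrix, not_lt.2 hij.le, hij.ne']

lemma innovationMatrix_mulVec {X : Type*} (k : X → X → ℝ) (σ : ℝ) {n : ℕ} (a : Fin n → X)
    (y : Fin n → ℝ) (i : Fin n) :
    (innovationMatrix k σ a *ᵥ y) i =
      y i - postWeights k σ (prefixPts a i) (a i) ⬝ᵥ fun j => y (Fin.castLE i.isLt.le j) := by
  have h1 : ∀ j, innovationMatrix k σ a i j * y j = (if j = i then y j else 0) -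
      if h : j < i then postWeights k σ (prefixPts a i) (a i) ⟨j, h⟩ * y j else 0 := by
    intro j
    by_cases hj : j < i
    · simp [innovationMatrix, hj, hj.ne]
    · by_cases hj' : j = i <;> simp [innovationMatrix, hj, hj']
  simp only [Matrix.mulVec, dotProduct, h1, Finset.sum_sub_distrib]
  congr 1
  · simp
  · symm
    refine Finset.sum_of_injOn (Fin.castLE i.isLt.le) (Fin.castLE_injective _).injOn (by simp)
      (fun j _ hj => ?_) fun j _ => ?_
    · rw [dif_neg]
      intro hji
      exact hj ⟨⟨j, hji⟩, by simp, rfl⟩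
    · rw [dif_pos (show Fin.castLE i.isLt.le j < i from j.isLt)]
      rfl

/-- An innovation is the prediction error of `f (a i)` from the earlier observations plus fresh
noise; hence its variance is posterior variance plus `σ ^ 2`. -/
lemma innovation_eq {X Ω : Type*} (k : X → X → ℝ) (σ : ℝ) {n : ℕ} (f : X → Ω → ℝ)
    (e : Fin n → Ω → ℝ) (a : Fin n → X) (i : Fin n) (ω : Ω) :
    (innovationMatrix k σ a *ᵥ obs f e a ω) i =
      residual k σ f (fun j : Fin i => e (Fin.castLE i.isLt.le j)) (prefixPts a i) (a i) ω +
        e i ω := by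
  rw [innovationMatrix_mulVec]
  exact add_sub_right_comm _ _ _

/-- Variance of the innovation in round `i`. -/
def innovationVar {X : Type*} (k : X → X → ℝ) (σ : ℝ) {n : ℕ} (a : Fin n → X) (i : Fin n) :
    NNReal :=
  (condVar k σ (prefixPts a i) (a i) + σ ^ 2).toNNReal

namespace IsNoisyGP

variable {X Ω : Type*} [MeasurableSpace Ω] {P : Measure Ω} {n : ℕ} {k : X → X → ℝ} {σ : ℝ}
  {f : X → Ω → ℝ} {e : Fin n → Ω → ℝ}

lemma comp (h : IsNoisyGP k σ f e P) {m : ℕ} {r : Fin m → Fin n} (hr : r.Injective) :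
    IsNoisyGP k σ f (fun j => e (r j)) P where
  gp := h.gp
  noise_measurable j := h.noise_measurable (r j)
  noise_law j := h.noise_law (r j)
  noise_indep := h.noise_indep.precomp hr
  indep := h.indep.comp (ψ := fun (y : Fin n → ℝ) j => y (r j)) measurable_id (by fun_prop)

lemma prefixNoise (h : IsNoisyGP k σ f e P) (i : Fin n) :
    IsNoisyGP k σ f (fun j : Fin i => e (Fin.castLE i.isLt.le j)) P :=
  h.comp (Fin.castLE_injective _)

lemma memLp_innovation (h : IsNoisyGP k σ f e P) (a : Fin n → X) (i : Fin n) :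
    MemLp (fun ω => (innovationMatrix k σ a *ᵥ obs f e a ω) i) 2 P := by
  simp only [innovation_eq]
  exact ((h.prefixNoise i).memLp_residual _ _).add (h.memLp_noise i)

lemma covariance_innovation_obs (h : IsNoisyGP k σ f e P) (hk : (Matrix.of k).PosSemidef)
    (hσ : 0 < σ) (a : Fin n → X) {i j : Fin n} (hji : j < i) :
    cov[fun ω => (innovationMatrix k σ a *ᵥ obs f e a ω) i, fun ω => obs f e a ω j; P] = 0 := by
  have := h.isProbabilityMeasure
  simp only [innovation_eq]
  have h1 := covariance_add_left ((h.prefixNoise i).memLp_residual (prefixPts a i) (a i))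
    (h.memLp_noise i) (h.memLp_obs a j)
  rw [h.covariance_noise_obs, if_neg hji.ne'] at h1
  have h2 := (h.prefixNoise i).covariance_residual_obs hk hσ (prefixPts a i) (a i) ⟨j, hji⟩
  refine h1.trans ?_
  rw [add_zero]
  exact h2

/-- The earlier innovation combines only observations up to `j`, each uncorrelated with the later
one. -/
lemma covariance_innovation (h : IsNoisyGP k σ f e P) (hk : (Matrix.of k).PosSemidef)
    (hσ : 0 < σ) (a : Fin n → X) {i j : Fin n} (hji : j < i) :
    cov[fun ω => (innovationMatrix k σ a *ᵥ obs f e a ω) i,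
      fun ω => (innovationMatrix k σ a *ᵥ obs f e a ω) j; P] = 0 := by
  have := h.isProbabilityMeasure
  have h1 : (fun ω => (innovationMatrix k σ a *ᵥ obs f e a ω) j) =
      fun ω => ∑ l, innovationMatrix k σ a j l * obs f e a ω l := rfl
  rw [h1, covariance_fun_sum_right (fun l => (h.memLp_obs a l).const_mul _)
    (h.memLp_innovation a i)]
  refine Finset.sum_eq_zero fun l _ => ?_
  rw [covariance_const_mul_right]
  rcases le_or_gt l j with hl | hl
  · rw [h.covariance_innovation_obs hk hσ a (hl.trans_lt hji), mul_zero]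
  · simp [innovationMatrix, not_lt.2 hl.le, hl.ne']

lemma variance_innovation (h : IsNoisyGP k σ f e P) (hk : (Matrix.of k).PosSemidef)
    (hσ : 0 < σ) (a : Fin n → X) (i : Fin n) :
    Var[fun ω => (innovationMatrix k σ a *ᵥ obs f e a ω) i; P] =
      condVar k σ (prefixPts a i) (a i) + σ ^ 2 := by
  have := h.isProbabilityMeasure
  have h' := h.prefixNoise i
  simp only [innovation_eq]
  have h1 := h'.memLp_residual (prefixPts a i) (a i)
  have h2 : cov[residual k σ f (fun j : Fin i => e (Fin.castLE i.isLt.le j)) (prefixPts a i) (a i),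
      e i; P] = 0 := by
    rw [h'.covariance_residual_left _ _ (h.memLp_noise i), h.covariance_f_noise]
    refine (zero_sub _).trans (neg_eq_zero.2 (Finset.sum_eq_zero fun l _ => ?_))
    have h3 := h.covariance_noise_obs a i (Fin.castLE i.isLt.le l)
    rw [if_neg (fun hil => by
      have := congrArg Fin.val hil
      simp only [Fin.val_castLE] at this
      omega), covariance_comm] at h3
    exact mul_eq_zero_of_right _ h3
  have h4 := variance_add h1 (h.memLp_noise i)
  rw [h2, h'.variance_residual hk hσ, h.variance_noise] at h4
  refine Eq.trans h4 ?_
  ring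

lemma integral_innovation (h : IsNoisyGP k σ f e P) (a : Fin n → X) (i : Fin n) :
    ∫ ω, (innovationMatrix k σ a *ᵥ obs f e a ω) i ∂P = 0 := by
  have := h.isProbabilityMeasure
  have h' := h.prefixNoise i
  simp only [innovation_eq]
  rw [integral_add ((h'.memLp_residual _ _).integrable one_le_two)
    ((h.memLp_noise i).integrable one_le_two), h'.integral_residual, h.integral_noise, add_zero]

lemma coe_innovationVar (h : IsNoisyGP k σ f e P) (hk : (Matrix.of k).PosSemidef)
    (hσ : 0 < σ) (a : Fin n → X) (i : Fin n) :
    (innovationVar k σ a i : ℝ) = condVar k σ (prefixPts a i) (a i) + σ ^ 2 :=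
  Real.coe_toNNReal _
    (add_nonneg ((h.prefixNoise i).condVar_nonneg hk hσ _ _) (sq_nonneg σ))

lemma innovationVar_ne_zero (h : IsNoisyGP k σ f e P) (hk : (Matrix.of k).PosSemidef)
    (hσ : 0 < σ) (a : Fin n → X) (i : Fin n) : innovationVar k σ a i ≠ 0 := by
  have h1 := h.coe_innovationVar hk hσ a i
  have h2 := (h.prefixNoise i).condVar_nonneg hk hσ (prefixPts a i) (a i)
  intro h0
  rw [h0, NNReal.coe_zero] at h1
  nlinarith [sq_pos_of_pos hσ]

lemma map_innovation [Fintype X] (h : IsNoisyGP k σ f e P) (hk : (Matrix.of k).PosSemidef)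
    (hσ : 0 < σ) (a : Fin n → X) :
    P.map (fun ω => innovationMatrix k σ a *ᵥ obs f e a ω) =
      Measure.pi fun i => gaussianReal 0 (innovationVar k σ a i) := by
  have := h.isProbabilityMeasure
  have hG : HasGaussianLaw (fun ω => innovationMatrix k σ a *ᵥ obs f e a ω) P :=
    (h.hasGaussianLaw_residual_obs (k := k) (σ := σ) a).snd.map_fun
      (LinearMap.toContinuousLinearMap (Matrix.toLin' (innovationMatrix k σ a)))
  have hind : iIndepFun (fun i ω => (innovationMatrix k σ a *ᵥ obs f e a ω) i) P := by
    refine HasGaussianLaw.iIndepFun_of_covariance_eq_zero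
      (X := fun i ω => (innovationMatrix k σ a *ᵥ obs f e a ω) i) hG fun i j hij => ?_
    rcases lt_or_gt_of_ne hij with hij | hij
    · rw [covariance_comm, h.covariance_innovation hk hσ a hij]
    · exact h.covariance_innovation hk hσ a hij
  have hG' : ∀ i, HasGaussianLaw (fun ω => (innovationMatrix k σ a *ᵥ obs f e a ω) i) P :=
    fun i => HasGaussianLaw.eval (X := fun i ω => (innovationMatrix k σ a *ᵥ obs f e a ω) i) hG i
  have h1 := (iIndepFun_iff_map_fun_eq_pi_map fun i => (hG' i).aemeasurable).1 hind
  refine h1.trans ?_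
  congr with i : 1
  rw [(hG' i).map_eq_gaussianReal, h.integral_innovation, h.variance_innovation hk hσ]
  rfl

/-- The innovations are independent normals; undoing the unit triangular map gives a product form of
the density, without the determinant of `K + σ² I`. -/
lemma map_obs [Fintype X] (h : IsNoisyGP k σ f e P) (hk : (Matrix.of k).PosSemidef)
    (hσ : 0 < σ) (a : Fin n → X) :
    P.map (obs f e a) = volume.withDensity fun y => ENNReal.ofReal
      (∏ i, gaussianPDFReal 0 (innovationVar k σ a i) ((innovationMatrix k σ a *ᵥ y) i)) := by
  set L := innovationMatrix k σ a with hL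
  have hdet : L.det = 1 := det_innovationMatrix k σ a
  have hunit : IsUnit L.det := by simp [hdet]
  have hdet' : L⁻¹.det = 1 := by simp [Matrix.det_nonsing_inv, hdet]
  have hT : MeasurePreserving (Matrix.toLin' L⁻¹) (volume : Measure (Fin n → ℝ)) volume := by
    refine ⟨(Matrix.toLin' L⁻¹).continuous_of_finiteDimensional.measurable, ?_⟩
    rw [Real.map_matrix_volume_pi_eq_smul_volume_pi (by simp [hdet']), hdet']
    simp
  have hLm : Measurable fun y : Fin n → ℝ => L *ᵥ y :=
    (Matrix.toLin' L).continuous_of_finiteDimensional.measurable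
  have hp : Measurable fun y : Fin n → ℝ => ENNReal.ofReal
      (∏ i, gaussianPDFReal 0 (innovationVar k σ a i) ((L *ᵥ y) i)) := by
    refine (Finset.measurable_prod _ fun i _ => ?_).ennreal_ofReal
    exact (measurable_gaussianPDFReal _ _).comp ((measurable_pi_apply i).comp hLm)
  rw [← map_withDensity_of_measurePreserving hT hp]
  have h1 : ∀ z : Fin n → ℝ, L *ᵥ (Matrix.toLin' L⁻¹ z) = z := fun z => by
    rw [Matrix.toLin'_apply, Matrix.mulVec_mulVec, Matrix.mul_nonsing_inv _ hunit,
      Matrix.one_mulVec]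
  simp only [h1]
  rw [← pi_gaussianReal_eq_withDensity _ fun i => h.innovationVar_ne_zero hk hσ a i,
    ← h.map_innovation hk hσ a, Measure.map_map hT.measurable
      (show Measurable fun ω => L *ᵥ obs f e a ω from hLm.comp (h.measurable_obs a))]
  congr with ω : 1
  simp [Matrix.mulVec_mulVec, Matrix.nonsing_inv_mul _ hunit]

lemma map_noise (h : IsNoisyGP k σ f e P) :
    P.map (fun ω i => e i ω) = Measure.pi fun _ => gaussianReal 0 (Real.toNNReal (σ ^ 2)) := by
  have := h.isProbabilityMeasure
  rw [(iIndepFun_iff_map_fun_eq_pi_map fun i => (h.noise_measurable i).aemeasurable).1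
    h.noise_indep]
  congr with i : 1
  exact (h.noise_law i).map_eq

/-- The reference measure keeps the law of `f_A` as a factor, because that law may have no Lebesgue
density (repeated points, singular kernel). -/
lemma map_obs_prodMk (h : IsNoisyGP k σ f e P) (hσ : 0 < σ) (a : Fin n → X) :
    P.map (fun ω => (obs f e a ω, fun i => f (a i) ω)) =
      ((volume : Measure (Fin n → ℝ)).prod (P.map fun ω i => f (a i) ω)).withDensity fun p =>
        ENNReal.ofReal (∏ i, gaussianPDFReal 0 (Real.toNNReal (σ ^ 2)) (p.1 i - p.2 i)) := by
  have := h.isProbabilityMeasure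
  have hF : Measurable fun ω i => f (a i) ω := measurable_pi_lambda _ fun i => h.gp.measurable _
  have hE : Measurable fun ω i => e i ω := measurable_pi_lambda _ h.noise_measurable
  have : IsProbabilityMeasure (P.map fun ω i => f (a i) ω) :=
    Measure.isProbabilityMeasure_map hF.aemeasurable
  have hv : Real.toNNReal (σ ^ 2) ≠ 0 := by simpa using hσ.ne'
  -- The shear `(F, e) ↦ (F + e, F)` turns the pair (values, noise) into (observations, values).
  have hT := Measure.measurePreserving_swap.comp (measurePreserving_prod_add
    (P.map fun ω i => f (a i) ω) (volume : Measure (Fin n → ℝ)))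
  have hp : Measurable fun p : (Fin n → ℝ) × (Fin n → ℝ) =>
      ENNReal.ofReal (∏ i, gaussianPDFReal 0 (Real.toNNReal (σ ^ 2)) (p.1 i - p.2 i)) := by
    refine (Finset.measurable_prod _ fun i _ => ?_).ennreal_ofReal
    exact (measurable_gaussianPDFReal _ _).comp (by fun_prop)
  have hind : IndepFun (fun ω i => f (a i) ω) (fun ω i => e i ω) P :=
    h.indep.comp (φ := fun (y : X → ℝ) i => y (a i)) (by fun_prop) measurable_id
  rw [← map_withDensity_of_measurePreserving hT hp]
  simp only [Function.comp_apply, Prod.fst_swap, Prod.snd_swap, Pi.add_apply, add_sub_cancel_left]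
  have hg : Measurable fun y : Fin n → ℝ =>
      ENNReal.ofReal (∏ i, gaussianPDFReal 0 (Real.toNNReal (σ ^ 2)) (y i)) := by
    refine (Finset.measurable_prod _ fun i _ => ?_).ennreal_ofReal
    exact (measurable_gaussianPDFReal _ _).comp (measurable_pi_apply i)
  have hpi := pi_gaussianReal_eq_withDensity (fun _ : Fin n => Real.toNNReal (σ ^ 2)) fun _ => hv
  have : SFinite ((volume : Measure (Fin n → ℝ)).withDensity fun y =>
      ENNReal.ofReal (∏ i, gaussianPDFReal 0 (Real.toNNReal (σ ^ 2)) (y i))) := by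
    rw [← hpi]; infer_instance
  rw [← prod_withDensity_right hg, ← hpi, ← h.map_noise,
    ← (indepFun_iff_map_prod_eq_prod_map_map hF.aemeasurable hE.aemeasurable).1 hind,
    Measure.map_map hT.measurable (hF.prodMk hE)]
  rfl

/-- Closed form of the information gain. -/
theorem mutualInfo_obs [Fintype X] (h : IsNoisyGP k σ f e P) (hk : (Matrix.of k).PosSemidef)
    (hσ : 0 < σ) (a : Fin n → X) :
    mutualInfo P (obs f e a) (fun ω i => f (a i) ω) = ENNReal.ofReal
      (∑ i, Real.log (1 + (σ ^ 2)⁻¹ * condVar k σ (prefixPts a i) (a i)) / 2) := by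
  have := h.isProbabilityMeasure
  have hF : Measurable fun ω i => f (a i) ω := measurable_pi_lambda _ fun i => h.gp.measurable _
  have hY := h.measurable_obs a
  have : IsProbabilityMeasure (P.map fun ω i => f (a i) ω) :=
    Measure.isProbabilityMeasure_map hF.aemeasurable
  have : IsProbabilityMeasure (P.map (obs f e a)) :=
    Measure.isProbabilityMeasure_map hY.aemeasurable
  have : IsProbabilityMeasure (P.map fun ω => (obs f e a ω, fun i => f (a i) ω)) :=
    Measure.isProbabilityMeasure_map (hY.prodMk hF).aemeasurable
  set s := Real.toNNReal (σ ^ 2) with hs_def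
  set v := innovationVar k σ a with hv_def
  set L := innovationMatrix k σ a with hL_def
  have hs : s ≠ 0 := by simpa [hs_def] using hσ.ne'
  have hs' : (s : ℝ) = σ ^ 2 := Real.coe_toNNReal _ (sq_nonneg σ)
  have hv : ∀ i, v i ≠ 0 := fun i => h.innovationVar_ne_zero hk hσ a i
  have hv' : ∀ i, (v i : ℝ) = condVar k σ (prefixPts a i) (a i) + σ ^ 2 :=
    fun i => h.coe_innovationVar hk hσ a i
  have hLm : Measurable fun y : Fin n → ℝ => L *ᵥ y :=
    (Matrix.toLin' L).continuous_of_finiteDimensional.measurable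
  have hgm : Measurable fun p : (Fin n → ℝ) × (Fin n → ℝ) =>
      ∏ i, gaussianPDFReal 0 s (p.1 i - p.2 i) :=
    Finset.measurable_prod _ fun i _ => (measurable_gaussianPDFReal _ _).comp (by fun_prop)
  have hqm' : Measurable fun y : Fin n → ℝ => ∏ i, gaussianPDFReal 0 (v i) ((L *ᵥ y) i) :=
    Finset.measurable_prod _ fun i _ =>
      (measurable_gaussianPDFReal _ _).comp ((measurable_pi_apply i).comp hLm)
  have hqm : Measurable fun p : (Fin n → ℝ) × (Fin n → ℝ) =>
      ∏ i, gaussianPDFReal 0 (v i) ((L *ᵥ p.1) i) := hqm'.comp measurable_fst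
  have hQ : (P.map (obs f e a)).prod (P.map fun ω i => f (a i) ω) =
      ((volume : Measure (Fin n → ℝ)).prod (P.map fun ω i => f (a i) ω)).withDensity fun p =>
        ENNReal.ofReal (∏ i, gaussianPDFReal 0 (v i) ((L *ᵥ p.1) i)) := by
    have hmo := h.map_obs hk hσ a
    have : SFinite ((volume : Measure (Fin n → ℝ)).withDensity fun y =>
        ENNReal.ofReal (∏ i, gaussianPDFReal 0 (v i) ((L *ᵥ y) i))) := by
      rw [← hmo]; infer_instance
    rw [hmo, prod_withDensity_left hqm'.ennreal_ofReal]
  have hlog : ∀ ω, Real.log (∏ i, gaussianPDFReal 0 s (obs f e a ω i - f (a i) ω)) -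
      Real.log (∏ i, gaussianPDFReal 0 (v i) ((L *ᵥ obs f e a ω) i)) =
      ∑ i, (Real.log (1 + (σ ^ 2)⁻¹ * condVar k σ (prefixPts a i) (a i)) / 2 -
        e i ω ^ 2 / (2 * s) + (L *ᵥ obs f e a ω) i ^ 2 / (2 * v i)) := by
    intro ω
    rw [Real.log_prod fun i _ => (gaussianPDFReal_pos _ _ _ hs).ne',
      Real.log_prod fun i _ => (gaussianPDFReal_pos _ _ _ (hv i)).ne', ← Finset.sum_sub_distrib]
    refine Finset.sum_congr rfl fun i _ => ?_
    have hvpos : (0 : ℝ) < v i := by have := hv i; positivity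
    have hspos : (0 : ℝ) < s := by positivity
    have h1 : 1 + (σ ^ 2)⁻¹ * condVar k σ (prefixPts a i) (a i) =
        (2 * Real.pi * v i) / (2 * Real.pi * s) := by
      rw [mul_div_mul_left _ _ (by positivity), hv', hs']
      field_simp
      ring
    rw [log_gaussianPDFReal hs, log_gaussianPDFReal (hv i), h1,
      Real.log_div (by positivity) (by positivity)]
    simp only [obs, add_sub_cancel_left]
    ring
  have hi1 : ∀ i, Integrable (fun ω => e i ω ^ 2 / (2 * (s : ℝ))) P :=
    fun i => (h.memLp_noise i).integrable_sq.div_const _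
  have hi2 : ∀ i, Integrable (fun ω => (L *ᵥ obs f e a ω) i ^ 2 / (2 * (v i : ℝ))) P :=
    fun i => (h.memLp_innovation a i).integrable_sq.div_const _
  have hi0 : ∀ i, Integrable (fun ω =>
      Real.log (1 + (σ ^ 2)⁻¹ * condVar k σ (prefixPts a i) (a i)) / 2 -
        e i ω ^ 2 / (2 * (s : ℝ))) P := fun i => (integrable_const _).sub (hi1 i)
  have hi : ∀ i, Integrable (fun ω =>
      Real.log (1 + (σ ^ 2)⁻¹ * condVar k σ (prefixPts a i) (a i)) / 2 -
        e i ω ^ 2 / (2 * (s : ℝ)) + (L *ᵥ obs f e a ω) i ^ 2 / (2 * (v i : ℝ))) P :=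
    fun i => (hi0 i).add (hi2 i)
  have hYF := (hY.prodMk hF).aemeasurable (μ := P)
  have hmeas : Measurable fun p : (Fin n → ℝ) × (Fin n → ℝ) =>
      Real.log (∏ i, gaussianPDFReal 0 s (p.1 i - p.2 i)) -
        Real.log (∏ i, gaussianPDFReal 0 (v i) ((L *ᵥ p.1) i)) :=
    (Real.measurable_log.comp hgm).sub (Real.measurable_log.comp hqm)
  rw [mutualInfo, klDiv_eq_of_density hgm hqm
    (fun p => Finset.prod_pos fun i _ => gaussianPDFReal_pos _ _ _ hs)
    (fun p => Finset.prod_pos fun i _ => gaussianPDFReal_pos _ _ _ (hv i))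
    (h.map_obs_prodMk hσ a) hQ, integral_map hYF hmeas.aestronglyMeasurable]
  · congr 1
    simp only [hlog]
    rw [integral_finsetSum _ fun i _ => hi i]
    refine Finset.sum_congr rfl fun i _ => ?_
    -- Both normalised squares have mean `1 / 2` and cancel, leaving the logarithm of the variance
    -- ratio.
    have hvar1 : ∫ ω, e i ω ^ 2 ∂P = s := by
      rw [← variance_of_integral_eq_zero (h.noise_measurable i).aemeasurable (h.integral_noise i),
        h.variance_noise, hs']
    have hvar2 : ∫ ω, (L *ᵥ obs f e a ω) i ^ 2 ∂P = v i := by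
      rw [← variance_of_integral_eq_zero (h.memLp_innovation a i).aemeasurable
        (h.integral_innovation a i), h.variance_innovation hk hσ, hv']
    rw [integral_add (hi0 i) (hi2 i), integral_sub (integrable_const _) (hi1 i), integral_div,
      integral_div, integral_div, hvar1, hvar2]
    have h1 : (s : ℝ) ≠ 0 := by exact_mod_cast hs
    have h2 : (v i : ℝ) ≠ 0 := by exact_mod_cast hv i
    simp only [integral_const, probReal_univ, one_smul]
    field_simp
    ring
  · rw [integrable_map_measure hmeas.aestronglyMeasurable hYF]
    simp only [Function.comp_def, hlog]
    exact integrable_finsetSum _ fun i _ => hi i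

end IsNoisyGP

/-! ### Maximum information gain -/

section InfoGain

variable {X : Type*} [Fintype X] {k : X → X → ℝ} {σ : ℝ}

/-- Carries the general results to the canonical space defining the information gain. It also
supplies a process for every kernel, so that `condVar_nonneg` applies where none is given. -/
lemma isNoisyGP_modelMeasure (hk : (Matrix.of k).PosSemidef) (σ : ℝ) (T : ℕ) :
    IsNoisyGP k σ (fun x (p : EuclideanSpace ℝ X × (Fin T → ℝ)) => p.1 x) (fun i p => p.2 i)
      (modelMeasure k σ T) := by
  classical
  let μ : Measure (EuclideanSpace ℝ X) := multivariateGaussian 0 (Matrix.of k)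
  let ν : Measure (Fin T → ℝ) := Measure.pi fun _ => gaussianReal 0 (Real.toNNReal (σ ^ 2))
  have hM : modelMeasure k σ T = μ.prod ν := by
    unfold modelMeasure
    congr
  have hfst : HasLaw (Prod.fst : EuclideanSpace ℝ X × (Fin T → ℝ) → _) μ (μ.prod ν) :=
    measurePreserving_fst.hasLaw
  have hsnd : HasLaw (Prod.snd : EuclideanSpace ℝ X × (Fin T → ℝ) → _) ν (μ.prod ν) :=
    measurePreserving_snd.hasLaw
  rw [hM]
  refine ⟨⟨fun x => by fun_prop, ⟨fun I => ?_⟩, fun x => ?_, fun x x' => ?_⟩, fun i => by fun_prop,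
    fun i => ?_, ?_, ?_⟩
  · let L : EuclideanSpace ℝ X →L[ℝ] (↥I → ℝ) :=
      ContinuousLinearMap.pi fun x => (EuclideanSpace.proj x.1 : EuclideanSpace ℝ X →L[ℝ] ℝ)
    exact hfst.hasGaussianLaw.map_fun L
  · have h1 := hfst.integral_comp (f := fun y : EuclideanSpace ℝ X => y x)
      (by fun_prop : Measurable fun y : EuclideanSpace ℝ X => y x).aestronglyMeasurable
    refine h1.trans ?_
    have h2 := (EuclideanSpace.proj x : EuclideanSpace ℝ X →L[ℝ] ℝ).integral_comp_comm
      (IsGaussian.integrable_id (μ := μ))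
    simp only [id] at h2
    rw [integral_id_multivariateGaussian] at h2
    simpa using h2
  · have h1 := hfst.covariance_fun_comp (f := fun y : EuclideanSpace ℝ X => y x)
      (g := fun y => y x') (by fun_prop) (by fun_prop)
    exact h1.trans (covariance_eval_multivariateGaussian hk x x')
  · exact (measurePreserving_eval (fun _ : Fin T => gaussianReal 0 (Real.toNNReal (σ ^ 2)))
      i).hasLaw.fun_comp hsnd
  · rw [iIndepFun_iff_map_fun_eq_pi_map fun i => by fun_prop]
    refine hsnd.map_eq.trans ?_
    simp only [ν]
    congr with i : 1
    exact ((measurePreserving_eval (fun _ : Fin T => gaussianReal 0 (Real.toNNReal (σ ^ 2)))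
      i).hasLaw.fun_comp hsnd).map_eq.symm
  · exact indepFun_prod (X := fun (y : EuclideanSpace ℝ X) x => y x) (Y := fun (y : Fin T → ℝ) => y)
      (by fun_prop) (by fun_prop)

lemma infoGain_eq (hk : (Matrix.of k).PosSemidef) (hσ : 0 < σ) {T : ℕ} (a : Fin T → X) :
    infoGain k σ a = ENNReal.ofReal
      (∑ i, Real.log (1 + (σ ^ 2)⁻¹ * condVar k σ (prefixPts a i) (a i)) / 2) :=
  (isNoisyGP_modelMeasure hk σ T).mutualInfo_obs hk hσ a

lemma sum_log_le_maxInfoGain (hk : (Matrix.of k).PosSemidef) (hσ : 0 < σ) {T : ℕ}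
    (a : Fin T → X) :
    ∑ i, Real.log (1 + (σ ^ 2)⁻¹ * condVar k σ (prefixPts a i) (a i)) / 2 ≤
      maxInfoGain k σ T := by
  refine (ENNReal.ofReal_le_iff_le_toReal ?_).1 ?_
  -- There are finitely many designs, each of finite gain, so `toReal` does not fall back to its
  -- default `0`.
  · refine iSup_ne_top fun a => ?_
    rw [infoGain_eq hk hσ]
    exact ENNReal.ofReal_ne_top
  · rw [← infoGain_eq hk hσ]
    exact le_iSup (fun a : Fin T → X => infoGain k σ a) a

/-- Concavity of `log` on the chord from `1` to `1 + b`; `b = σ⁻²` yields the constant `C₁`. -/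
lemma mul_log_one_add_le {b c : ℝ} (hb : 0 ≤ b) (hc0 : 0 ≤ c) (hc1 : c ≤ 1) :
    c * Real.log (1 + b) ≤ Real.log (1 + b * c) := by
  have h1 := strictConcaveOn_log_Ioi.concaveOn.2 (Set.mem_Ioi.2 one_pos)
    (Set.mem_Ioi.2 (by positivity : 0 < 1 + b)) (sub_nonneg.2 hc1) hc0 (by ring)
  simp only [smul_eq_mul, Real.log_one, mul_zero, zero_add] at h1
  refine h1.trans_eq ?_
  congr 1
  ring

/-- The posterior variances at successively queried points sum up to at most a constant times the
maximum information gain. -/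
lemma sum_condVar_le (hk : (Matrix.of k).PosSemidef) (hk1 : ∀ x, k x x ≤ 1) (hσ : 0 < σ) {T : ℕ}
    (a : Fin T → X) :
    ∑ i, condVar k σ (prefixPts a i) (a i) ≤
      2 / Real.log (1 + (σ ^ 2)⁻¹) * maxInfoGain k σ T := by
  have hb : 0 < (σ ^ 2)⁻¹ := by positivity
  have hlog : 0 < Real.log (1 + (σ ^ 2)⁻¹) := Real.log_pos (by linarith)
  have h1 : ∀ i, condVar k σ (prefixPts a i) (a i) ≤ 2 / Real.log (1 + (σ ^ 2)⁻¹) *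
      (Real.log (1 + (σ ^ 2)⁻¹ * condVar k σ (prefixPts a i) (a i)) / 2) := fun i => by
    have h2 := mul_log_one_add_le hb.le
      ((isNoisyGP_modelMeasure hk σ i).condVar_nonneg hk hσ (prefixPts a i) (a i))
      ((condVar_le hk hσ (prefixPts a i) (a i)).trans (hk1 _))
    rw [← le_div_iff₀ hlog] at h2
    refine h2.trans_eq ?_
    ring
  refine (Finset.sum_le_sum fun i _ => h1 i).trans ?_
  rw [← Finset.mul_sum]
  exact mul_le_mul_of_nonneg_left (sum_log_le_maxInfoGain hk hσ a) (by positivity)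

end InfoGain

/-! ### Conditioning on a finite history and independence -/

/-- With finitely many histories, a quantity along the random history is a finite sum over fixed
ones, for which the Gaussian results hold. -/
lemma eq_sum_indicator_fiber {Ω ι : Type*} [Fintype ι] (H : Ω → ι) (g : ι → Ω → ℝ) :
    (fun ω => g (H ω) ω) = fun ω => ∑ c, {ω | H ω = c}.indicator (g c) ω := by
  classical
  ext ω
  simp [Set.indicator_apply]

section Fibers

variable {Ω ι : Type*} [MeasurableSpace Ω] {P : Measure Ω} [Fintype ι] {H : Ω → ι}
  {g : ι → Ω → ℝ}

lemma integrable_fiber (hH : ∀ c, MeasurableSet {ω | H ω = c}) (hg : ∀ c, Integrable (g c) P) :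
    Integrable (fun ω => g (H ω) ω) P := by
  rw [eq_sum_indicator_fiber]
  exact integrable_finsetSum _ fun c _ => (hg c).indicator (hH c)

lemma integral_fiber_eq (hH : ∀ c, MeasurableSet {ω | H ω = c}) (hg : ∀ c, Integrable (g c) P) :
    ∫ ω, g (H ω) ω ∂P = ∑ c, ∫ ω in {ω | H ω = c}, g c ω ∂P := by
  rw [eq_sum_indicator_fiber, integral_finsetSum _ fun c _ => (hg c).indicator (hH c)]
  exact Finset.sum_congr rfl fun c _ => integral_indicator (hH c)

end Fibers

lemma indepFun_prodMk_right {Ω α β γ : Type*} [MeasurableSpace Ω] [MeasurableSpace α]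
    [MeasurableSpace β] [MeasurableSpace γ] {P : Measure Ω} [IsProbabilityMeasure P] {A : Ω → α}
    {B : Ω → β} {C : Ω → γ} (hA : Measurable A) (hB : Measurable B) (hC : Measurable C)
    (hAB : IndepFun A B P) (hABC : IndepFun (fun ω => (A ω, B ω)) C P) :
    IndepFun A (fun ω => (B ω, C ω)) P := by
  have := Measure.isProbabilityMeasure_map (μ := P) hA.aemeasurable
  have := Measure.isProbabilityMeasure_map (μ := P) hB.aemeasurable
  have := Measure.isProbabilityMeasure_map (μ := P) hC.aemeasurable
  have hBC : IndepFun B C P := hABC.comp measurable_snd measurable_id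
  rw [indepFun_iff_map_prod_eq_prod_map_map hA.aemeasurable (hB.prodMk hC).aemeasurable,
    (indepFun_iff_map_prod_eq_prod_map_map hB.aemeasurable hC.aemeasurable).1 hBC]
  have h1 := (indepFun_iff_map_prod_eq_prod_map_map (hA.prodMk hB).aemeasurable
    hC.aemeasurable).1 hABC
  rw [(indepFun_iff_map_prod_eq_prod_map_map hA.aemeasurable hB.aemeasurable).1 hAB] at h1
  have h2 := congrArg (Measure.map MeasurableEquiv.prodAssoc) h1
  rw [Measure.map_map MeasurableEquiv.prodAssoc.measurable ((hA.prodMk hB).prodMk hC)] at h2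
  rw [← Measure.prodAssoc_prod]
  exact h2

/-- Fubini in place of conditioning on `W`: on an event determined by `W`, the independent `R` is
integrated out with `W` frozen. -/
lemma setIntegral_eq_of_indepFun {Ω α γ : Type*} [MeasurableSpace Ω] [MeasurableSpace α]
    [MeasurableSpace γ] {P : Measure Ω} [IsProbabilityMeasure P] {R : Ω → α} {W : Ω → γ}
    (hR : Measurable R) (hW : Measurable W) (hRW : IndepFun R W P) {S : Set γ}
    (hS : MeasurableSet S) {Φ : α × γ → ℝ} (hΦ : Measurable Φ)
    (hi : Integrable (fun ω => Φ (R ω, W ω)) P) :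
    Integrable (fun w => ∫ ω, Φ (R ω, w) ∂P) (P.map W) ∧
      ∫ ω in W ⁻¹' S, Φ (R ω, W ω) ∂P = ∫ w in S, ∫ ω, Φ (R ω, w) ∂P ∂(P.map W) := by
  have := Measure.isProbabilityMeasure_map (μ := P) hR.aemeasurable
  have := Measure.isProbabilityMeasure_map (μ := P) hW.aemeasurable
  have hRWm := (hR.prodMk hW).aemeasurable (μ := P)
  have hmap := (indepFun_iff_map_prod_eq_prod_map_map hR.aemeasurable hW.aemeasurable).1 hRW
  have hi' : Integrable Φ ((P.map R).prod (P.map W)) := by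
    rw [← hmap, integrable_map_measure hΦ.aestronglyMeasurable hRWm]
    exact hi
  have hin : ∀ w, ∫ r, Φ (r, w) ∂(P.map R) = ∫ ω, Φ (R ω, w) ∂P := fun w =>
    integral_map hR.aemeasurable (hΦ.comp measurable_prodMk_right).aestronglyMeasurable
  refine ⟨?_, ?_⟩
  · simp only [← hin]
    exact hi'.integral_prod_right
  · have hpre : W ⁻¹' S = (fun ω => (R ω, W ω)) ⁻¹' (Set.univ ×ˢ S) := by ext; simp
    have hset : MeasurableSet ((Set.univ : Set α) ×ˢ S) := MeasurableSet.univ.prod hS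
    rw [hpre, ← setIntegral_map (f := Φ) hset hΦ.aestronglyMeasurable hRWm, hmap,
      ← Measure.prod_restrict, Measure.restrict_univ, integral_prod_symm]
    · simp only [hin]
    · have h1 := hi'.integrableOn (s := Set.univ ×ˢ S)
      rwa [IntegrableOn, ← Measure.prod_restrict, Measure.restrict_univ] at h1

/-! ### The history of the algorithm -/

/-- The queries of the first `t` rounds. -/
def history {X Ω : Type*} (x : ℕ → Ω → X) (t : ℕ) (ω : Ω) : Fin t → X := fun i => x i ω

lemma dataset_eq {X Ω : Type*} {f : X → Ω → ℝ} {ε : ℕ → Ω → ℝ} {x : ℕ → Ω → X} {t : ℕ}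
    {c : Fin t → X}
    {ω : Ω} (hω : history x t ω = c) :
    dataset f ε x t ω = fun i => (c i, obs f (fun i : Fin t => ε i) c ω i) := by
  subst hω
  rfl

lemma IsRun.exists_measurableSet {X Ω : Type*} [MeasurableSpace X] [MeasurableSingletonClass X]
    {k : X → X → ℝ} {σ : ℝ} {f : X → Ω → ℝ} {ε ζ : ℕ → Ω → ℝ} {x : ℕ → Ω → X}
    (h : IsRun k σ f ε ζ x) (t : ℕ) (z : X) :
    ∃ S : Set ((Fin t → X × ℝ) × (Fin (t + 1) → ℝ)), MeasurableSet S ∧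
      ∀ ω, x t ω = z ↔ (dataset f ε x t ω, fun i : Fin (t + 1) => ζ i ω) ∈ S := by
  obtain ⟨S, hS, hSx⟩ := h.adapted t (measurableSet_singleton z)
  refine ⟨S, hS, fun ω => ?_⟩
  have h1 := Set.ext_iff.1 hSx ω
  simp only [Set.mem_preimage, Set.mem_singleton_iff] at h1
  exact h1.symm

/-- The event that the first queries are `c` is determined by the confidence parameters and the
noisy observations at the points `c`. -/
lemma IsRun.measurableSet_history_eq {X Ω : Type*} [MeasurableSpace X] [MeasurableSingletonClass X]
    {k : X → X → ℝ} {σ : ℝ} {f : X → Ω → ℝ} {ε ζ : ℕ → Ω → ℝ} {x : ℕ → Ω → X}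
    (h : IsRun k σ f ε ζ x) {t : ℕ} (c : Fin t → X) (m : MeasurableSpace Ω)
    (hY : ∀ i : Fin t, (i : ℕ) + 1 < t → Measurable[m] fun ω => f (c i) ω + ε i ω)
    (hζ : ∀ i : Fin t, Measurable[m] (ζ i)) :
    MeasurableSet[m] {ω | history x t ω = c} := by
  -- Induction over rounds: while the queries agree with `c`, the data set is the one observed at
  -- `c`. Round `s` uses observations of rounds before `s` only, so the last of the `t` observations
  -- is never needed, hence `i + 1 < t` in `hY`.
  have key : ∀ s ≤ t, MeasurableSet[m] {ω | ∀ i : Fin t, (i : ℕ) < s → x i ω = c i} := by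
    intro s
    induction s with
    | zero => intro _; simp
    | succ s ih =>
      intro hs
      obtain ⟨S, hS, hSx⟩ := h.exists_measurableSet s (c ⟨s, hs⟩)
      let U : Ω → (Fin s → X × ℝ) × (Fin (s + 1) → ℝ) := fun ω =>
        (fun i => (c (Fin.castLE (by omega) i), f (c (Fin.castLE (by omega) i)) ω + ε i ω),
          fun i => ζ i ω)
      have hU : Measurable[m] U := by
        refine Measurable.prodMk (measurable_pi_lambda _ fun i => ?_)
          (measurable_pi_lambda _ fun i => hζ (Fin.castLE hs i))
        exact measurable_const.prodMk (hY (Fin.castLE (by omega) i) (by simp; omega))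
      have h1 : {ω | ∀ i : Fin t, (i : ℕ) < s + 1 → x i ω = c i} =
          {ω | ∀ i : Fin t, (i : ℕ) < s → x i ω = c i} ∩ U ⁻¹' S := by
        ext ω
        have hdata : (∀ i : Fin t, (i : ℕ) < s → x i ω = c i) →
            (x s ω = c ⟨s, hs⟩ ↔ U ω ∈ S) := by
          intro hω
          have h2 : (dataset f ε x s ω, fun i : Fin (s + 1) => ζ i ω) = U ω := by
            refine Prod.ext (funext fun i => ?_) rfl
            have h3 : x i ω = c (Fin.castLE (by omega) i) :=
              hω (Fin.castLE (by omega) i) i.isLt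
            simp [U, dataset, observation, h3]
          rw [← h2]
          exact hSx ω
        constructor
        · intro hω
          have hω' : ∀ i : Fin t, (i : ℕ) < s → x i ω = c i := fun i hi => hω i (by omega)
          exact ⟨hω', (hdata hω').1 (hω ⟨s, hs⟩ (Nat.lt_succ_self s))⟩
        · rintro ⟨hω, hωS⟩ i hi
          rcases Nat.lt_succ_iff_lt_or_eq.1 hi with hi | hi
          · exact hω i hi
          · have : i = ⟨s, hs⟩ := Fin.ext hi
            subst this
            exact (hdata hω).2 hωS
      rw [h1]
      exact (ih (by omega)).inter (hU hS)
  have h1 := key t le_rfl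
  have h2 : {ω | history x t ω = c} = {ω | ∀ i : Fin t, (i : ℕ) < t → x i ω = c i} := by
    ext ω; simp [history, funext_iff]
  rw [h2]
  exact h1

/-- All assumptions on the model and the run of the algorithm. -/
structure IsModel {X Ω : Type*} [Fintype X] [MeasurableSpace X] [MeasurableSpace Ω]
    (P : Measure Ω) (k : X → X → ℝ) (σ : ℝ) (f : X → Ω → ℝ) (ε ζ : ℕ → Ω → ℝ) (x : ℕ → Ω → X) :
    Prop where
  posSemidef : (Matrix.of k).PosSemidef
  kernel_le : ∀ x, k x x ≤ 1
  pos : 0 < σ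
  gp : IsGPSample k f P
  noise_measurable : ∀ t, Measurable (ε t)
  noise_law : ∀ t, HasLaw (ε t) (gaussianReal 0 (Real.toNNReal (σ ^ 2))) P
  noise_indep : iIndepFun ε P
  conf_measurable : ∀ t, Measurable (ζ t)
  conf_law : ∀ t, HasLaw (ζ t)
    (shiftedExpMeasure (2 * Real.log ((Fintype.card X : ℝ) / 2)) (1 / 2)) P
  conf_indep : iIndepFun ζ P
  indep : IndepFun (fun ω x => f x ω) (fun ω t => ε t ω) P
  indep_conf :
    IndepFun (fun ω => ((fun x => f x ω), (fun t => ε t ω))) (fun ω t => ζ t ω) P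
  run : IsRun k σ f ε ζ x

namespace IsModel

variable {X Ω : Type*} [Fintype X] [MeasurableSpace X] [MeasurableSpace Ω] {P : Measure Ω}
    {k : X → X → ℝ} {σ : ℝ} {f : X → Ω → ℝ} {ε ζ : ℕ → Ω → ℝ}
  {x : ℕ → Ω → X}

lemma isNoisyGP (h : IsModel P k σ f ε ζ x) (t : ℕ) :
    IsNoisyGP k σ f (fun i : Fin t => ε i) P where
  gp := h.gp
  noise_measurable i := h.noise_measurable i
  noise_law i := h.noise_law i
  noise_indep := h.noise_indep.precomp Fin.val_injective
  indep := h.indep.comp (ψ := fun (y : ℕ → ℝ) (i : Fin t) => y i) measurable_id (by fun_prop)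

lemma measurable_eval [MeasurableSingletonClass X] (h : IsModel P k σ f ε ζ x) {g : Ω → X}
    (hg : Measurable g) :
    Measurable fun ω => f (g ω) ω := by
  have h1 : Measurable fun p : X × Ω => f p.1 p.2 :=
    measurable_from_prod_countable_right fun z => h.gp.measurable z
  exact h1.comp (hg.prodMk measurable_id)

lemma measurable_query [MeasurableSingletonClass X] (h : IsModel P k σ f ε ζ x) (t : ℕ) :
    Measurable (x t) := by
  induction t using Nat.strong_induction_on with
  | _ t ih =>
    refine (h.run.adapted t).mono ?_ le_rfl
    rw [← measurable_iff_comap_le]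
    refine Measurable.prodMk (measurable_pi_lambda _ fun i => ?_)
      (measurable_pi_lambda _ fun i => h.conf_measurable i)
    exact (ih i i.isLt).prodMk ((h.measurable_eval (ih i i.isLt)).add (h.noise_measurable i))

lemma measurableSet_history_eq [MeasurableSingletonClass X] (h : IsModel P k σ f ε ζ x) (t : ℕ)
    (c : Fin t → X) :
    MeasurableSet {ω | history x t ω = c} := by
  have h1 : {ω | history x t ω = c} = ⋂ i : Fin t, (x i) ⁻¹' {c i} := by
    ext ω; simp [history, funext_iff]
  rw [h1]
  exact MeasurableSet.iInter fun i => h.measurable_query i (measurableSet_singleton _)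

/-! ### Independence of the residuals from the history -/

lemma measurable_conf_prefix (h : IsModel P k σ f ε ζ x) (m : ℕ) :
    Measurable fun ω (i : Fin m) => ζ i ω :=
  measurable_pi_lambda _ fun i => h.conf_measurable i

lemma measurable_residual_pi (h : IsModel P k σ f ε ζ x) {t : ℕ} (c : Fin t → X) :
    Measurable fun ω z => residual k σ f (fun i : Fin t => ε i) c z ω :=
  measurable_pi_lambda _ fun z => (h.isNoisyGP t).measurable_residual c z

lemma isProbabilityMeasure (h : IsModel P k σ f ε ζ x) : IsProbabilityMeasure P :=
  (IsGPSample.isGaussianProcess h.gp).isProbabilityMeasure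

/-- Residual and observations are functions of `(f, ε)`, so `ζ` can be adjoined. The free `m` allows
`t` parameters before the query of round `t` and `t + 1` after it. -/
lemma indepFun_residual (h : IsModel P k σ f ε ζ x) {t : ℕ} (c : Fin t → X) (m : ℕ) :
    IndepFun (fun ω z => residual k σ f (fun i : Fin t => ε i) c z ω)
      (fun ω => (obs f (fun i : Fin t => ε i) c ω, fun i : Fin m => ζ i ω)) P := by
  have := h.isProbabilityMeasure
  refine indepFun_prodMk_right (h.measurable_residual_pi c) ((h.isNoisyGP t).measurable_obs c)
    (h.measurable_conf_prefix m) ((h.isNoisyGP t).indepFun_residual_obs h.posSemidef h.pos c) ?_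
  let φ : ((X → ℝ) × (ℕ → ℝ)) → (X → ℝ) × (Fin t → ℝ) := fun p =>
    (fun z => p.1 z - ∑ i : Fin t, postWeights k σ c z i * (p.1 (c i) + p.2 i),
      fun i => p.1 (c i) + p.2 i)
  exact h.indep_conf.comp (φ := φ) (ψ := fun (q : ℕ → ℝ) (i : Fin m) => q i) (by fun_prop)
    (by fun_prop)

lemma indepFun_conf (h : IsModel P k σ f ε ζ x) {t : ℕ} (c : Fin t → X) :
    IndepFun (ζ t) (fun ω => (obs f (fun i : Fin t => ε i) c ω, fun i : Fin t => ζ i ω)) P := by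
  have := h.isProbabilityMeasure
  have h1 : IndepFun (ζ t) (fun ω (i : Fin t) => ζ i ω) P := by
    have h2 := h.conf_indep.indepFun_finset {t} (Finset.range t) (by simp) h.conf_measurable
    exact h2.comp (φ := fun (q : ↥({t} : Finset ℕ) → ℝ) => q ⟨t, by simp⟩)
      (ψ := fun (q : ↥(Finset.range t) → ℝ) (i : Fin t) => q ⟨i, by simp⟩) (by fun_prop)
        (by fun_prop)
  have h2 : IndepFun (fun ω => (ζ t ω, fun i : Fin t => ζ i ω))
      (obs f (fun i : Fin t => ε i) c) P := by
    let φ : ((X → ℝ) × (ℕ → ℝ)) → (Fin t → ℝ) := fun p i => p.1 (c i) + p.2 i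
    exact h.indep_conf.symm.comp (φ := fun (q : ℕ → ℝ) => (q t, fun i : Fin t => q i)) (ψ := φ)
      (by fun_prop) (by fun_prop)
  have h3 := indepFun_prodMk_right (h.conf_measurable t) (h.measurable_conf_prefix t)
    ((h.isNoisyGP t).measurable_obs c) h1 h2
  exact h3.comp measurable_id measurable_swap

end IsModel

/-! ### Regret bounds -/

lemma iSup_ucb_eq {X Ω : Type*} {k : X → X → ℝ} {σ : ℝ} {f : X → Ω → ℝ} {ε : ℕ → Ω → ℝ}
    {ζ : ℕ → Ω → ℝ} {x : ℕ → Ω → X} (t : ℕ) :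
    (fun ω => ⨆ z, ucb k σ (ζ t ω) (dataset f ε x t ω) z) = fun ω => ⨆ z,
      (postWeights k σ (history x t ω) z ⬝ᵥ obs f (fun i : Fin t => ε i) (history x t ω) ω +
        √(ζ t ω) * √(condVar k σ (history x t ω) z)) := by
  ext ω
  simp only [ucb, dataset_eq (f := f) (ε := ε) (x := x) (t := t) (ω := ω) rfl, postMean_eq,
    postVar_eq]

/-- The posterior mean at the queried point, in terms of the history of queries. -/
lemma postMean_query_eq {X Ω : Type*} {k : X → X → ℝ} {σ : ℝ} {f : X → Ω → ℝ} {ε : ℕ → Ω → ℝ}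
    {x : ℕ → Ω → X} (t : ℕ) (ω : Ω) :
    postMean k σ (dataset f ε x t ω) (x t ω) =
      postWeights k σ (Fin.init (history x (t + 1) ω)) (history x (t + 1) ω (Fin.last t)) ⬝ᵥ
        obs f (fun i : Fin t => ε i) (Fin.init (history x (t + 1) ω)) ω := by
  rw [dataset_eq (f := f) (ε := ε) (x := x) (t := t) (ω := ω) rfl, postMean_eq]
  rfl

lemma postVar_query_eq {X Ω : Type*} {k : X → X → ℝ} {σ : ℝ} {f : X → Ω → ℝ} {ε : ℕ → Ω → ℝ}
    {x : ℕ → Ω → X} {t T : ℕ} (ht : t < T) (ω : Ω) :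
    postVar k σ (dataset f ε x t ω) (x t ω) =
      condVar k σ (prefixPts (history x T ω) ⟨t, ht⟩) (history x T ω ⟨t, ht⟩) := by
  rw [postVar_eq]
  rfl

namespace IsModel

variable {X Ω : Type*} [Fintype X] [MeasurableSpace X] [MeasurableSpace Ω] {P : Measure Ω}
    {k : X → X → ℝ} {σ : ℝ} {f : X → Ω → ℝ} {ε ζ : ℕ → Ω → ℝ}
  {x : ℕ → Ω → X}

lemma integrable_f (h : IsModel P k σ f ε ζ x) (z : X) : Integrable (f z) P :=
  ((IsGPSample.isGaussianProcess h.gp).hasGaussianLaw_eval z).integrable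

lemma integrable_conf (h : IsModel P k σ f ε ζ x) (t : ℕ) : Integrable (ζ t) P := by
  have := h.isProbabilityMeasure
  exact integrable_of_shiftedExp (by norm_num) (h.conf_law t)

lemma integrable_sqrt_conf (h : IsModel P k σ f ε ζ x) (t : ℕ) :
    Integrable (fun ω => √(ζ t ω)) P := by
  have := h.isProbabilityMeasure
  exact integrable_sqrt_of_integrable (h.integrable_conf t)

lemma integrable_postMean_obs (h : IsModel P k σ f ε ζ x) {t : ℕ} (c : Fin t → X) (z : X) :
    Integrable (fun ω => postWeights k σ c z ⬝ᵥ obs f (fun i : Fin t => ε i) c ω) P := by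
  have := h.isProbabilityMeasure
  simp only [dotProduct]
  exact integrable_finsetSum _ fun i _ =>
    (((h.isNoisyGP t).memLp_obs c i).integrable one_le_two).const_mul _

lemma integrable_eval [MeasurableSingletonClass X]
    (h : IsModel P k σ f ε ζ x) (t : ℕ) :
    Integrable (fun ω => f (x t ω) ω) P :=
  integrable_fiber (g := f) (fun z => h.measurable_query t (measurableSet_singleton z))
    h.integrable_f

lemma integrable_iSup_f [Nonempty X]
    (h : IsModel P k σ f ε ζ x) : Integrable (fun ω => ⨆ z, f z ω) P :=
  integrable_iSup h.integrable_f

lemma integrable_iSup_ucb_fiber [Nonempty X]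
    (h : IsModel P k σ f ε ζ x) {t : ℕ} (c : Fin t → X) :
    Integrable (fun ω => ⨆ z, (postWeights k σ c z ⬝ᵥ obs f (fun i : Fin t => ε i) c ω +
      √(ζ t ω) * √(condVar k σ c z))) P :=
  integrable_iSup fun z =>
    (h.integrable_postMean_obs c z).add ((h.integrable_sqrt_conf t).mul_const _)

/-- The expected maximum of `f` is at most the expected maximal upper confidence bound. -/
lemma integral_iSup_le_integral_iSup_ucb [Nonempty X] [MeasurableSingletonClass X]
    (h : IsModel P k σ f ε ζ x) (hX : 2 ≤ Fintype.card X)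
    (t : ℕ) :
    ∫ ω, ⨆ z, f z ω ∂P ≤ ∫ ω, ⨆ z, ucb k σ (ζ t ω) (dataset f ε x t ω) z ∂P := by
  have := h.isProbabilityMeasure
  have hH := h.measurableSet_history_eq t
  have e1 := integral_fiber_eq (H := history x t) (g := fun (_ : Fin t → X) ω => ⨆ z, f z ω) hH
    fun _ => h.integrable_iSup_f
  have e2 := integral_fiber_eq (H := history x t) (g := fun c ω => ⨆ z,
    (postWeights k σ c z ⬝ᵥ obs f (fun i : Fin t => ε i) c ω + √(ζ t ω) * √(condVar k σ c z)))
    hH fun c => h.integrable_iSup_ucb_fiber c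
  rw [iSup_ucb_eq, e1, e2]
  refine Finset.sum_le_sum fun c _ => ?_
  let W : Ω → (Fin t → ℝ) × (Fin t → ℝ) := fun ω =>
    (obs f (fun i : Fin t => ε i) c ω, fun i : Fin t => ζ i ω)
  let R : Ω → X → ℝ := fun ω z => residual k σ f (fun i : Fin t => ε i) c z ω
  -- With `W` frozen, `Φ` is the maximum of `f` as a function of the residual and `Ψ` the maximal
  -- confidence bound as a function of the fresh `ζ t`; both share the same posterior means.
  let Φ : (X → ℝ) × ((Fin t → ℝ) × (Fin t → ℝ)) → ℝ := fun p =>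
    ⨆ z, (postWeights k σ c z ⬝ᵥ p.2.1 + p.1 z)
  let Ψ : ℝ × ((Fin t → ℝ) × (Fin t → ℝ)) → ℝ := fun p =>
    ⨆ z, (postWeights k σ c z ⬝ᵥ p.2.1 + √p.1 * √(condVar k σ c z))
  have hWm : Measurable W :=
    ((h.isNoisyGP t).measurable_obs c).prodMk (h.measurable_conf_prefix t)
  have hΦm : Measurable Φ := Measurable.iSup fun z => by
    simp only [dotProduct]; fun_prop
  have hΨm : Measurable Ψ := Measurable.iSup fun z => by
    simp only [dotProduct]; fun_prop
  obtain ⟨S, hS, hSW⟩ : MeasurableSet[MeasurableSpace.comap W inferInstance]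
      {ω | history x t ω = c} := by
    have hW : Measurable[MeasurableSpace.comap W inferInstance] W := comap_measurable W
    exact h.run.measurableSet_history_eq c _
      (fun i _ => (measurable_pi_apply i).comp (measurable_fst.comp hW))
      (fun i => (measurable_pi_apply i).comp (measurable_snd.comp hW))
  have hfΦ : (fun ω => ⨆ z, f z ω) = fun ω => Φ (R ω, W ω) := by
    ext ω
    simp [Φ, R, W, residual]
  have hΦi : Integrable (fun ω => Φ (R ω, W ω)) P := hfΦ ▸ h.integrable_iSup_f
  have hΨi : Integrable (fun ω => Ψ (ζ t ω, W ω)) P := h.integrable_iSup_ucb_fiber c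
  obtain ⟨i1, E1⟩ := setIntegral_eq_of_indepFun (h.measurable_residual_pi c) hWm
    (h.indepFun_residual c t) hS hΦm hΦi
  obtain ⟨i2, E2⟩ := setIntegral_eq_of_indepFun (h.conf_measurable t) hWm
    (h.indepFun_conf c) hS hΨm hΨi
  rw [← hSW, hfΦ]
  refine E1.trans_le (le_trans ?_ E2.symm.le)
  refine setIntegral_mono i1.integrableOn i2.integrableOn fun w => ?_
  exact integral_iSup_le_of_shiftedExp (fun z => postWeights k σ c z ⬝ᵥ w.1) (condVar k σ c)
    (fun z => (h.isNoisyGP t).measurable_residual c z)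
    (fun z => (h.isNoisyGP t).map_residual h.posSemidef h.pos c z) hX (h.conf_law t)

/-! ### Posterior mean and variance at the queried point -/

lemma integrable_postMean_query [MeasurableSingletonClass X]
    (h : IsModel P k σ f ε ζ x) (t : ℕ) :
    Integrable (fun ω => postMean k σ (dataset f ε x t ω) (x t ω)) P := by
  simp only [postMean_query_eq]
  exact integrable_fiber (H := history x (t + 1)) (g := fun c ω =>
    postWeights k σ (Fin.init c) (c (Fin.last t)) ⬝ᵥ
      obs f (fun i : Fin t => ε i) (Fin.init c) ω)
    (h.measurableSet_history_eq (t + 1)) fun c => h.integrable_postMean_obs _ _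

/-- The posterior mean at the queried point is unbiased. -/
lemma integral_postMean_query [MeasurableSingletonClass X]
    (h : IsModel P k σ f ε ζ x) (t : ℕ) :
    ∫ ω, postMean k σ (dataset f ε x t ω) (x t ω) ∂P = ∫ ω, f (x t ω) ω ∂P := by
  have := h.isProbabilityMeasure
  have hH := h.measurableSet_history_eq (t + 1)
  have e1 := integral_fiber_eq (H := history x (t + 1)) (g := fun c ω =>
    residual k σ f (fun i : Fin t => ε i) (Fin.init c) (c (Fin.last t)) ω) hH
    fun c => ((h.isNoisyGP t).memLp_residual _ _).integrable one_le_two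
  have e2 : ∀ ω, residual k σ f (fun i : Fin t => ε i) (Fin.init (history x (t + 1) ω))
      (history x (t + 1) ω (Fin.last t)) ω =
      f (x t ω) ω - postMean k σ (dataset f ε x t ω) (x t ω) := fun ω => by
    rw [postMean_query_eq]
    rfl
  simp only [e2] at e1
  rw [integral_sub (h.integrable_eval t) (h.integrable_postMean_query t)] at e1
  refine (sub_eq_zero.1 (e1.trans (Finset.sum_eq_zero fun c _ => ?_))).symm
  -- The query of round `t` also depends on `ζ t`, so `W` holds `t + 1` parameters but only `t`
  -- observations. The residual is independent of `W` and centred.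
  let W : Ω → (Fin t → ℝ) × (Fin (t + 1) → ℝ) := fun ω =>
    (obs f (fun i : Fin t => ε i) (Fin.init c) ω, fun i : Fin (t + 1) => ζ i ω)
  have hWm : Measurable W :=
    ((h.isNoisyGP t).measurable_obs _).prodMk (h.measurable_conf_prefix (t + 1))
  obtain ⟨S, hS, hSW⟩ : MeasurableSet[MeasurableSpace.comap W inferInstance]
      {ω | history x (t + 1) ω = c} := by
    have hW : Measurable[MeasurableSpace.comap W inferInstance] W := comap_measurable W
    exact h.run.measurableSet_history_eq c _
      (fun i hi => (measurable_pi_apply (⟨i, by omega⟩ : Fin t)).comp (measurable_fst.comp hW))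
      (fun i => (measurable_pi_apply i).comp (measurable_snd.comp hW))
  have hΦm : Measurable fun p : (X → ℝ) × ((Fin t → ℝ) × (Fin (t + 1) → ℝ)) =>
      p.1 (c (Fin.last t)) := by fun_prop
  obtain ⟨-, E1⟩ := setIntegral_eq_of_indepFun (h.measurable_residual_pi (Fin.init c)) hWm
    (h.indepFun_residual (Fin.init c) (t + 1)) hS hΦm
    (((h.isNoisyGP t).memLp_residual _ _).integrable one_le_two)
  rw [← hSW]
  refine E1.trans ?_
  simp only [(h.isNoisyGP t).integral_residual, integral_zero]

lemma postVar_query_nonneg (h : IsModel P k σ f ε ζ x) (t : ℕ) (ω : Ω) :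
    0 ≤ postVar k σ (dataset f ε x t ω) (x t ω) := by
  rw [postVar_eq]
  exact (h.isNoisyGP t).condVar_nonneg h.posSemidef h.pos _ _

/-- The posterior variance depends on the queries alone and so takes finitely many values; `φ` need
not be measurable. -/
lemma integrable_comp_postVar_query [MeasurableSingletonClass X]
    (h : IsModel P k σ f ε ζ x) (t : ℕ) {Z : Ω → ℝ}
    (hZ : Integrable Z P) (φ : ℝ → ℝ) :
    Integrable (fun ω => Z ω * φ (postVar k σ (dataset f ε x t ω) (x t ω))) P := by
  simp only [postVar_query_eq (Nat.lt_succ_self t)]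
  exact integrable_fiber (H := history x (t + 1)) (g := fun c ω =>
    Z ω * φ (condVar k σ (prefixPts c ⟨t, Nat.lt_succ_self t⟩) (c ⟨t, Nat.lt_succ_self t⟩)))
    (h.measurableSet_history_eq (t + 1)) fun c => hZ.mul_const _

lemma integrable_postVar_query [MeasurableSingletonClass X]
    (h : IsModel P k σ f ε ζ x) (t : ℕ) :
    Integrable (fun ω => postVar k σ (dataset f ε x t ω) (x t ω)) P := by
  have := h.isProbabilityMeasure
  simpa using h.integrable_comp_postVar_query t (integrable_const 1) id

/-- Bound of the expected regret of a single round. -/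
lemma integral_regret_le [Nonempty X] [MeasurableSingletonClass X]
    (h : IsModel P k σ f ε ζ x) (hX : 2 ≤ Fintype.card X) (t : ℕ) :
    ∫ ω, ((⨆ z, f z ω) - f (x t ω) ω) ∂P ≤
      ∫ ω, √(ζ t ω) * √(postVar k σ (dataset f ε x t ω) (x t ω)) ∂P := by
  -- The maximality of the query enters here.
  have h1 : (fun ω => ⨆ z, ucb k σ (ζ t ω) (dataset f ε x t ω) z) = fun ω =>
      postMean k σ (dataset f ε x t ω) (x t ω) +
        √(ζ t ω) * √(postVar k σ (dataset f ε x t ω) (x t ω)) := by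
    ext ω
    exact le_antisymm (ciSup_le (h.run.isMax t ω))
      (le_ciSup (f := fun z => ucb k σ (ζ t ω) (dataset f ε x t ω) z)
        (Set.finite_range _).bddAbove (x t ω))
  have h2 := h.integral_iSup_le_integral_iSup_ucb hX t
  rw [h1, integral_add (h.integrable_postMean_query t)
    (h.integrable_comp_postVar_query t (h.integrable_sqrt_conf t) Real.sqrt),
    h.integral_postMean_query] at h2
  rw [integral_sub h.integrable_iSup_f (h.integrable_eval t)]
  linarith

lemma integrable_cumRegret [Nonempty X] [MeasurableSingletonClass X]
    (h : IsModel P k σ f ε ζ x) (T : ℕ) :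
    Integrable (cumRegret f x T) P :=
  integrable_finsetSum _ fun t _ => h.integrable_iSup_f.sub (h.integrable_eval t)

/-- The variance bound holds for every sequence of points, hence on each path, whatever the
adaptivity of the queries. -/
lemma integral_sum_postVar_le [MeasurableSingletonClass X]
    (h : IsModel P k σ f ε ζ x) (T : ℕ) :
    ∑ t ∈ Finset.range T, ∫ ω, postVar k σ (dataset f ε x t ω) (x t ω) ∂P ≤
      2 / Real.log (1 + (σ ^ 2)⁻¹) * maxInfoGain k σ T := by
  have := h.isProbabilityMeasure
  rw [← integral_finsetSum _ fun t _ => h.integrable_postVar_query t]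
  have h1 : ∀ ω, ∑ t ∈ Finset.range T, postVar k σ (dataset f ε x t ω) (x t ω) ≤
      2 / Real.log (1 + (σ ^ 2)⁻¹) * maxInfoGain k σ T := fun ω => by
    rw [Finset.sum_range]
    simp only [fun t : Fin T => postVar_query_eq (k := k) (σ := σ) (f := f) (ε := ε) (x := x)
      t.isLt ω]
    exact sum_condVar_le h.posSemidef h.kernel_le h.pos (history x T ω)
  refine (integral_mono (integrable_finsetSum _ fun t _ => h.integrable_postVar_query t)
    (integrable_const _) h1).trans_eq ?_
  simp

lemma integral_conf (h : IsModel P k σ f ε ζ x) (t : ℕ) :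
    ∫ ω, ζ t ω ∂P = 2 + 2 * Real.log ((Fintype.card X : ℝ) / 2) := by
  have := h.isProbabilityMeasure
  rw [integral_of_shiftedExp (by norm_num) (h.conf_law t)]
  ring

/-- Cauchy–Schwarz in weighted form, `√ζ * √v ≤ (l * ζ + l⁻¹ * v) / 2`: with one `l` for all rounds
the bound is linear and can be summed and integrated termwise. -/
lemma bcr_le_weighted [Nonempty X] [MeasurableSingletonClass X]
    (h : IsModel P k σ f ε ζ x) (hX : 2 ≤ Fintype.card X) (T : ℕ) {l : ℝ}
    (hl : 0 < l) :
    bcr P f x T ≤ (l * (T * (2 + 2 * Real.log ((Fintype.card X : ℝ) / 2))) +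
      l⁻¹ * (2 / Real.log (1 + (σ ^ 2)⁻¹) * maxInfoGain k σ T)) / 2 := by
  have := h.isProbabilityMeasure
  have hX' : (2 : ℝ) ≤ Fintype.card X := by exact_mod_cast hX
  have hs0 : 0 ≤ 2 * Real.log ((Fintype.card X : ℝ) / 2) :=
    mul_nonneg two_pos.le (Real.log_nonneg (by linarith))
  have h1 : ∀ t, ∫ ω, ((⨆ z, f z ω) - f (x t ω) ω) ∂P ≤
      (l * (2 + 2 * Real.log ((Fintype.card X : ℝ) / 2)) +
        l⁻¹ * ∫ ω, postVar k σ (dataset f ε x t ω) (x t ω) ∂P) / 2 := by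
    intro t
    refine (h.integral_regret_le hX t).trans ?_
    have hi1 := (h.integrable_conf t).const_mul l
    have hi2 := (h.integrable_postVar_query t).const_mul l⁻¹
    rw [← h.integral_conf t, ← integral_const_mul, ← integral_const_mul,
      ← integral_add hi1 hi2, ← integral_div]
    refine integral_mono_ae
      (h.integrable_comp_postVar_query t (h.integrable_sqrt_conf t) Real.sqrt)
      ((hi1.add hi2).div_const 2) ?_
    -- `√ζ ^ 2 = ζ` needs `ζ ≥ 0`, which is known only almost surely.
    filter_upwards [shift_le_ae (h.conf_law t)] with ω hω
    have hv := h.postVar_query_nonneg t ω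
    set v := postVar k σ (dataset f ε x t ω) (x t ω)
    have h2 : √(ζ t ω) ^ 2 = ζ t ω := Real.sq_sqrt (hs0.trans hω)
    have h3 : √v ^ 2 = v := Real.sq_sqrt hv
    have h4 : 0 ≤ l⁻¹ * (l * √(ζ t ω) - √v) ^ 2 := by positivity
    have h5 : l⁻¹ * (l * √(ζ t ω) - √v) ^ 2 =
        l * √(ζ t ω) ^ 2 - 2 * (√(ζ t ω) * √v) + l⁻¹ * √v ^ 2 := by
      field_simp
      ring
    rw [h5, h2, h3] at h4
    linarith
  have h6 : bcr P f x T = ∑ t ∈ Finset.range T, ∫ ω, ((⨆ z, f z ω) - f (x t ω) ω) ∂P :=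
    integral_finsetSum _ fun t _ => h.integrable_iSup_f.sub (h.integrable_eval t)
  rw [h6]
  refine (Finset.sum_le_sum fun t _ => h1 t).trans ?_
  rw [← Finset.sum_div, Finset.sum_add_distrib, ← Finset.mul_sum, Finset.sum_const,
    Finset.card_range, nsmul_eq_mul]
  have h7 := mul_le_mul_of_nonneg_left (h.integral_sum_postVar_le T) (inv_nonneg.2 hl.le)
  rw [Finset.mul_sum] at h7
  linarith

end IsModel

/-! ### Optimising the weight, and conclusion -/

lemma le_sqrt_mul_of_forall_weighted {b A B : ℝ} (hA : 0 ≤ A) (hB : 0 ≤ B)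
    (h : ∀ l > 0, b ≤ (l * A + l⁻¹ * B) / 2) : b ≤ √(A * B) := by
  rcases le_or_gt b 0 with hb | hb
  · exact hb.trans (Real.sqrt_nonneg _)
  refine Real.le_sqrt_of_sq_le ?_
  -- The hypothesis says that this quadratic is nonnegative for `l > 0`; for `l ≤ 0` this follows
  -- from `b > 0`. The discriminant then gives `b² ≤ A * B`, also when `A = 0` and no optimal `l`
  -- exists.
  have h1 : ∀ l : ℝ, 0 ≤ A * (l * l) + -(2 * b) * l + B := fun l => by
    rcases le_or_gt l 0 with hl | hl
    · nlinarith [mul_nonneg hA (mul_self_nonneg l), mul_nonneg hb.le (neg_nonneg.2 hl)]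
    · have h2 := mul_le_mul_of_nonneg_left (h l hl) (mul_nonneg two_pos.le hl.le)
      have h3 : 2 * l * ((l * A + l⁻¹ * B) / 2) = A * (l * l) + B := by
        field_simp
      linarith
  have h4 := discrim_le_zero h1
  rw [discrim] at h4
  linarith

end IRGPUCB

end

theorem mainTheorem1 {X Ω : Type*} [Fintype X] [Nonempty X]
    [MeasurableSpace X] [MeasurableSingletonClass X]
    [MeasurableSpace Ω] (P : Measure Ω) [IsProbabilityMeasure P]
    (k : X → X → ℝ) (hk : (Matrix.of k).PosSemidef) (hk1 : ∀ x, k x x ≤ 1)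
    (σ : ℝ) (hσ : 0 < σ)
    (f : X → Ω → ℝ) (hf : IRGPUCB.IsGPSample k f P)
    (ε : ℕ → Ω → ℝ) (hε_meas : ∀ t, Measurable (ε t))
    (hε_law : ∀ t, HasLaw (ε t) (gaussianReal 0 (Real.toNNReal (σ ^ 2))) P)
    (hε_indep : iIndepFun ε P)
    (ζ : ℕ → Ω → ℝ) (hζ_meas : ∀ t, Measurable (ζ t))
    (hζ_law : ∀ t, HasLaw (ζ t)
      (IRGPUCB.shiftedExpMeasure (2 * Real.log ((Fintype.card X : ℝ) / 2)) (1 / 2)) P)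
    (hζ_indep : iIndepFun ζ P)
    (hfε_indep : IndepFun (fun ω x => f x ω) (fun ω t => ε t ω) P)
    (hfεζ_indep : IndepFun (fun ω => ((fun x => f x ω), (fun t => ε t ω))) (fun ω t => ζ t ω) P)
    (x : ℕ → Ω → X) (hx : IRGPUCB.IsRun k σ f ε ζ x) (T : ℕ) :
    Integrable (IRGPUCB.cumRegret f x T) P ∧
    IRGPUCB.bcr P f x T ≤
      √((2 / Real.log (1 + (σ ^ 2)⁻¹)) * (2 + 2 * Real.log ((Fintype.card X : ℝ) / 2)) *
        T * IRGPUCB.maxInfoGain k σ T) := by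
  have h : IRGPUCB.IsModel P k σ f ε ζ x := ⟨hk, hk1, hσ, hf, hε_meas, hε_law, hε_indep, hζ_meas,
    hζ_law, hζ_indep, hfε_indep, hfεζ_indep, hx⟩
  refine ⟨h.integrable_cumRegret T, ?_⟩
  -- A one-point domain is separate: the shift `2 log (1 / 2)` is negative there, but the regret is
  -- zero.
  rcases (Nat.succ_le_iff.2 (Fintype.card_pos (α := X))).eq_or_lt with hX | hX
  · have : Subsingleton X := Fintype.card_le_one_iff_subsingleton.1 hX.ge
    have h0 : IRGPUCB.bcr P f x T = 0 := by
      have h1 : IRGPUCB.cumRegret f x T = fun _ => 0 := by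
        ext ω
        refine Finset.sum_eq_zero fun t _ => ?_
        have h2 : ∀ z, f z ω = f (x t ω) ω := fun z => by rw [Subsingleton.elim z (x t ω)]
        simp only [h2, ciSup_const, sub_self]
      simp [IRGPUCB.bcr, h1]
    rw [h0]
    exact Real.sqrt_nonneg _
  · have hX' : (2 : ℝ) ≤ Fintype.card X := by exact_mod_cast hX
    have hlog : 0 < Real.log (1 + (σ ^ 2)⁻¹) := Real.log_pos (by
      have : 0 < (σ ^ 2)⁻¹ := by positivity
      linarith)
    have hγ : 0 ≤ IRGPUCB.maxInfoGain k σ T := ENNReal.toReal_nonneg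
    have hC : 0 ≤ 2 + 2 * Real.log ((Fintype.card X : ℝ) / 2) := by
      have := Real.log_nonneg (show 1 ≤ (Fintype.card X : ℝ) / 2 by linarith)
      positivity
    refine (IRGPUCB.le_sqrt_mul_of_forall_weighted (by positivity) (by positivity)
      fun l hl => h.bcr_le_weighted hX T hl).trans_eq ?_
    congr 1
    ring
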